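/- Let $G$ be a finite abelian group with dual group $\widehat G=\mathrm{Hom}(G,\mathbb C^\times)$, and let $\mathcal B$ be the set of edges of the square lattice $\mathbb Z^2$, oriented to point right or up. For finite $\Lambda\subset\mathcal B$ let $\mathcal A_\Lambda=\mathcal B(\mathcal H_\Lambda)$, where $\mathcal H_\Lambda=\bigotimes_{e\in\Lambda}\mathbb C[G]$ has orthonormal basis $|b\rangle$, $b:\Lambda\to G$. With the inclusions $A\mapsto A\otimes I$, let $\mathcal A_{loc}=\bigcup_\Lambda\mathcal A_\Lambda$, and let $\mathcal A$ be its C*-completion. A state is a positive linear functional $\omega$ on $\mathcal A$ with $\omega(I)=1$; pure states are the extremal points of the convex set $\mathcal A^*_{+,1}$ of all states. For a vertex $v$ and $g\in G$ let $A_v^g$ be the unitary on the star of $v$ (the four edges at $v$) which multiplies the values $b(e)$ on edges $e$ starting at $v$ by $g$ and on edges ending at $v$ by $g^{-1}$. For a face $f$ and $h\in G$ let $B_f^h$ be the projection, on the four edges bounding $f$, onto the span of the $|b\rangle$ whose clockwise monodromy around $f$ (the product of $b(e)$ over the edges oriented clockwise and of $b(e)^{-1}$ over the others) equals $h$. Put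 $A_v=|G|^{-1}\sum_g A_v^g$ and $B_f=B_f^e$, where $e\in G$ is the unit. Let $\Lambda_L$ be the set of edges contained in $[-L,L]^2$, let $\mathcal V_L$ and $\mathcal F_L$ be the sets of vertices whose star, respectively faces whose bounding edges, lie in $\Lambda_L$, and let $$H_L=\sum_{v\in\mathcal V_L}(I-A_v)+\sum_{f\in\mathcal F_L}(I-B_f),\qquad \delta(A)=\lim_{L\to\infty}[H_L,A]\quad(A\in\mathcal A_{loc}).$$ Let $K$ be the set of infinite volume ground states, i.e. the states $\omega$ with $\omega(A^*\delta(A))\ge 0$ for all $A\in\mathcal A_{loc}$. For $\chi\in\widehat G$ and $c\in G$ put $D_v^\chi=|G|^{-1}\sum_g\overline{\chi(g)}A_v^g$, $D_f^c=B_f^c$, $$D_L^\chi=\sum_{\prod_v\chi_v=\chi}\ \prod_{v\in\mathcal V_L}D_v^{\chi_v},\qquad D_L^c=\sum_{\prod_f c_f=c}\ \prod_{f\in\mathcal F_L}D_f^{c_f},\qquad D_L^{\chi,c}=D_L^\chi D_L^c,$$ the sums being over all families $(\chi_v)_{v\in\mathcal V_L}$ in $\widehat G$ and $(c_f)_{f\in\mathcal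 F_L}$ in $G$ with the indicated product. Let $K^{\chi,c}$ be the set of states $\phi$ on $\mathcal A$ for which there is an $\omega\in K$ such that $\lim_{L\to\infty}\omega(D_L^{\chi,c})$ exists and is $>0$, and $$\phi(A)=\lim_{L\to\infty}\frac{\omega(A\,D_L^{\chi,c})}{\omega(D_L^{\chi,c})}\quad\text{for all }A\in\mathcal A.$$ Then, for every $(\chi,c)\in\widehat G\times G$, the set $K^{\chi,c}$ is a face of the set of all states: it is convex, and if $t\omega_1+(1-t)\omega_2\in K^{\chi,c}$ for states $\omega_1,\omega_2$ and some $0<t<1$, then $\omega_1,\omega_2\in K^{\chi,c}$. In particular, every extremal point of $K^{\chi,c}$ is a pure state. -/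

import Mathlib

open Filter Topology
open scoped ComplexOrder ComplexConjugate

namespace QuantumDouble

/-- Vertices of the square lattice. A face (unit square) is labelled by its lower left corner. -/
abbrev Vertex : Type := ℤ × ℤ

/-- Oriented edges of the square lattice: `(v, false)` points right, from `v` to `v + (1, 0)`;
`(v, true)` points up, from `v` to `v + (0, 1)`. -/
abbrev Edge : Type := Vertex × Bool

/-! ### Local observables as operators

The Hilbert space of a finite set `Λ` of edges is `ℂ[Λ → G]`, with algebra of observables
`Matrix (Λ → G) (Λ → G) ℂ`. All these algebras are represented simultaneously, and isometrically,
on the Hilbert space with orthonormal basis all configurations `Edge → G`; the quasi-local algebra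
is the norm closure of the union of their images. -/

section Operators
variable {G : Type*}

/-- Square summable functions on the set of configurations. -/
abbrev HilbertSp (G : Type*) : Type _ := lp (fun _ : Edge → G => ℂ) 2

/-- The configuration `c` with its values on `Λ` replaced by `d`. -/
def patch {Λ : Finset Edge} (c : Edge → G) (d : Λ → G) : Edge → G :=
  fun e => if h : e ∈ Λ then d ⟨e, h⟩ else c e

lemma restrict_patch {Λ : Finset Edge} (c : Edge → G) (d : Λ → G) : Λ.restrict (patch c d) = d := by
  funext e; simp [patch]

lemma patch_patch {Λ : Finset Edge} (c : Edge → G) (d d' : Λ → G) :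
    patch (patch c d) d' = patch c d' := by
  funext e; by_cases h : e ∈ Λ <;> simp [patch, h]

lemma patch_restrict {Λ : Finset Edge} (c : Edge → G) : patch c (Λ.restrict c) = c := by
  funext e; by_cases h : e ∈ Λ <;> simp [patch, h]

/-- Multiplication of a configuration by `k` on `Λ`. -/
def shift [Group G] {Λ : Finset Edge} (k : Λ → G) : (Edge → G) ≃ (Edge → G) where
  toFun c := patch c (k * Λ.restrict c)
  invFun c := patch c (k⁻¹ * Λ.restrict c)
  left_inv c := by simp [restrict_patch, patch_patch, patch_restrict]
  right_inv c := by simp [restrict_patch, patch_patch, patch_restrict]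

/-- The matrix `M` acts on the `Λ` part of a function of configurations. -/
def localFun [Fintype G] (Λ : Finset Edge) (M : Matrix (Λ → G) (Λ → G) ℂ) (ψ : (Edge → G) → ℂ) :
    (Edge → G) → ℂ :=
  fun c => ∑ d : Λ → G, M (Λ.restrict c) d * ψ (patch c d)

lemma localFun_eq_shift [Group G] [Fintype G] (Λ : Finset Edge) (M : Matrix (Λ → G) (Λ → G) ℂ)
    (ψ : (Edge → G) → ℂ) (c : Edge → G) :
    localFun Λ M ψ c = ∑ k : Λ → G, M (Λ.restrict c) (k * Λ.restrict c) * ψ (shift k c) :=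
  (Fintype.sum_equiv (Equiv.mulRight (Λ.restrict c)) _ _ (fun _ => rfl)).symm

lemma memlp_two_iff (ψ : (Edge → G) → ℂ) :
    Memℓp ψ 2 ↔ Summable fun c => ‖ψ c‖ ^ 2 := by
  rw [memℓp_gen_iff (by norm_num)]; simp

lemma norm_sq_eq (ψ : HilbertSp G) : ‖ψ‖ ^ 2 = ∑' c, ‖ψ c‖ ^ 2 := by
  have := lp.norm_rpow_eq_tsum (p := 2) (by norm_num) ψ
  simpa using this

def shiftVec (σ : (Edge → G) ≃ (Edge → G)) (ψ : HilbertSp G) : HilbertSp G :=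
  ⟨fun c => ψ (σ c), (memlp_two_iff _).2
    ((Equiv.summable_iff σ (f := fun c => ‖ψ c‖ ^ 2)).2 ((memlp_two_iff _).1 ψ.2))⟩

lemma norm_shiftVec (σ : (Edge → G) ≃ (Edge → G)) (ψ : HilbertSp G) : ‖shiftVec σ ψ‖ = ‖ψ‖ := by
  have h : ‖shiftVec σ ψ‖ ^ 2 = ‖ψ‖ ^ 2 := by
    rw [norm_sq_eq, norm_sq_eq]
    exact Equiv.tsum_eq σ (fun c => ‖ψ c‖ ^ 2)
  exact (pow_left_inj₀ (norm_nonneg _) (norm_nonneg _) two_ne_zero).1 h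

lemma memlp_mul {m : (Edge → G) → ℂ} {C : ℝ} (hm : ∀ c, ‖m c‖ ≤ C) (ψ : HilbertSp G) :
    Memℓp (fun c => m c * ψ c) 2 := by
  rw [memlp_two_iff]
  refine Summable.of_nonneg_of_le (fun c => by positivity) (fun c => ?_)
    (((memlp_two_iff _).1 ψ.2).mul_left (C ^ 2))
  rw [norm_mul, mul_pow]
  have := hm c
  gcongr

lemma norm_mul_le {m : (Edge → G) → ℂ} {C : ℝ} (hC : 0 ≤ C) (hm : ∀ c, ‖m c‖ ≤ C)
    (ψ : HilbertSp G) : ‖(⟨_, memlp_mul hm ψ⟩ : HilbertSp G)‖ ≤ C * ‖ψ‖ := by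
  refine (sq_le_sq₀ (norm_nonneg _) (by positivity)).1 ?_
  rw [mul_pow, norm_sq_eq, norm_sq_eq, ← tsum_mul_left]
  refine Summable.tsum_le_tsum (fun c => ?_) ((memlp_two_iff _).1 (memlp_mul hm ψ))
    (((memlp_two_iff _).1 ψ.2).mul_left (C ^ 2))
  change ‖m c * ψ c‖ ^ 2 ≤ _
  rw [norm_mul, mul_pow]
  have := hm c
  gcongr

lemma sum_apply {ι : Type*} (s : Finset ι) (f : ι → HilbertSp G) (c : Edge → G) :
    (∑ i ∈ s, f i : HilbertSp G) c = ∑ i ∈ s, f i c := by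
  rw [lp.coeFn_sum]; exact Finset.sum_apply c s _

variable [Fintype G]

lemma exists_entry_bound {Λ : Finset Edge} (M : Matrix (Λ → G) (Λ → G) ℂ) :
    ∃ C : ℝ, 0 ≤ C ∧ ∀ a b, ‖M a b‖ ≤ C := by
  refine ⟨∑ a, ∑ b, ‖M a b‖, by positivity, fun a b => ?_⟩
  calc ‖M a b‖ ≤ ∑ b, ‖M a b‖ :=
        Finset.single_le_sum (f := fun b => ‖M a b‖) (fun _ _ => norm_nonneg _) (Finset.mem_univ b)
    _ ≤ _ := Finset.single_le_sum (f := fun a => ∑ b, ‖M a b‖)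
        (fun _ _ => by positivity) (Finset.mem_univ a)

variable [Group G]

lemma memlp_term {Λ : Finset Edge} (M : Matrix (Λ → G) (Λ → G) ℂ) (k : Λ → G) (ψ : HilbertSp G) :
    Memℓp (fun c => M (Λ.restrict c) (k * Λ.restrict c) * ψ (shift k c)) 2 := by
  obtain ⟨C, -, hC⟩ := exists_entry_bound M
  exact memlp_mul (m := fun c => M (Λ.restrict c) (k * Λ.restrict c)) (fun c => hC _ _)
    (shiftVec (shift k) ψ)

lemma memlp_localFun (Λ : Finset Edge) (M : Matrix (Λ → G) (Λ → G) ℂ) (ψ : HilbertSp G) :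
    Memℓp (localFun Λ M ψ) 2 := by
  have h := lp.memℓp (∑ k : Λ → G, (⟨_, memlp_term M k ψ⟩ : HilbertSp G))
  convert h using 1
  funext c
  rw [localFun_eq_shift, sum_apply]

lemma localFun_eq_sum (Λ : Finset Edge) (M : Matrix (Λ → G) (Λ → G) ℂ) (ψ : HilbertSp G) :
    (⟨_, memlp_localFun Λ M ψ⟩ : HilbertSp G) = ∑ k : Λ → G, ⟨_, memlp_term M k ψ⟩ := by
  ext c
  change localFun Λ M ψ c = _
  rw [localFun_eq_shift, sum_apply]

/-- The operator `M ⊗ I` given by a matrix on `Λ`. -/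
noncomputable def localOp (Λ : Finset Edge) (M : Matrix (Λ → G) (Λ → G) ℂ) :
    HilbertSp G →L[ℂ] HilbertSp G :=
  LinearMap.mkContinuousOfExistsBound
    { toFun := fun ψ => ⟨localFun Λ M ψ, memlp_localFun Λ M ψ⟩
      map_add' := fun ψ φ => by
        ext c
        change ∑ d : Λ → G, M (Λ.restrict c) d * (ψ (patch c d) + φ (patch c d)) =
          localFun Λ M ψ c + localFun Λ M φ c
        simp only [localFun, mul_add, Finset.sum_add_distrib]
      map_smul' := fun z ψ => by
        ext c
        simp [localFun, Finset.mul_sum, mul_left_comm] }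
    (by
      obtain ⟨C, hC0, hC⟩ := exists_entry_bound M
      refine ⟨∑ _k : Λ → G, C, fun ψ => ?_⟩
      change ‖(⟨_, memlp_localFun Λ M ψ⟩ : HilbertSp G)‖ ≤ _
      rw [localFun_eq_sum, Finset.sum_mul]
      refine (norm_sum_le _ _).trans (Finset.sum_le_sum fun k _ => ?_)
      have := norm_mul_le (m := fun c => M (Λ.restrict c) (k * Λ.restrict c)) hC0
        (fun c => hC _ _) (shiftVec (shift k) ψ)
      rwa [norm_shiftVec] at this)

lemma localOp_apply (Λ : Finset Edge) (M : Matrix (Λ → G) (Λ → G) ℂ) (ψ : HilbertSp G)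
    (c : Edge → G) :
    localOp Λ M ψ c = ∑ d : Λ → G, M (Λ.restrict c) d * ψ (patch c d) := rfl

lemma localOp_mul (Λ : Finset Edge) (M N : Matrix (Λ → G) (Λ → G) ℂ) :
    localOp Λ (M * N) = localOp Λ M * localOp Λ N := by
  ext ψ c
  simp only [mul_apply_eq_comp, localOp_apply, restrict_patch, patch_patch,
    Matrix.mul_apply, Finset.sum_mul, Finset.mul_sum]
  rw [Finset.sum_comm]
  simp only [mul_assoc]

lemma localOp_star (Λ : Finset Edge) (M : Matrix (Λ → G) (Λ → G) ℂ) :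
    localOp Λ (star M) = star (localOp Λ M) := by
  rw [ContinuousLinearMap.star_eq_adjoint, ContinuousLinearMap.eq_adjoint_iff]
  intro x y
  have h1 : localOp Λ M y = ∑ k : Λ → G, ⟨_, memlp_term M k y⟩ := localFun_eq_sum Λ M y
  have h2 : localOp Λ (star M) x = ∑ k : Λ → G, ⟨_, memlp_term (star M) k x⟩ :=
    localFun_eq_sum Λ (star M) x
  rw [h1, h2, inner_sum, sum_inner]
  refine Fintype.sum_equiv (Equiv.inv _) _ _ fun k => ?_
  rw [lp.inner_eq_tsum, lp.inner_eq_tsum, ← Equiv.tsum_eq (shift k).symm]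
  refine tsum_congr fun c => ?_
  have h3 : ∀ c : Edge → G, (shift k).symm c = shift k⁻¹ c := fun c => rfl
  have h4 : Λ.restrict (shift k⁻¹ c) = k⁻¹ * Λ.restrict c := restrict_patch _ _
  have h5 : shift k (shift k⁻¹ c) = c := by rw [← h3]; simp
  simp only [h3, h4, h5, Equiv.inv_apply, mul_inv_cancel_left, RCLike.inner_apply, map_mul,
    Matrix.star_apply, RCLike.star_def, RingHomCompTriple.comp_apply, RingHom.id_apply]
  ring

lemma localOp_add (Λ : Finset Edge) (M N : Matrix (Λ → G) (Λ → G) ℂ) :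
    localOp Λ (M + N) = localOp Λ M + localOp Λ N := by
  ext ψ c
  rw [_root_.add_apply, lp.coeFn_add, Pi.add_apply]
  simp only [localOp_apply, Matrix.add_apply, add_mul, Finset.sum_add_distrib]

lemma localOp_smul (Λ : Finset Edge) (z : ℂ) (M : Matrix (Λ → G) (Λ → G) ℂ) :
    localOp Λ (z • M) = z • localOp Λ M := by
  ext ψ c
  rw [_root_.smul_apply, lp.coeFn_smul, Pi.smul_apply]
  simp only [localOp_apply, Matrix.smul_apply, smul_eq_mul, Finset.mul_sum, mul_assoc]

variable [DecidableEq G]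

lemma localOp_one (Λ : Finset Edge) :
    localOp Λ (1 : Matrix (Λ → G) (Λ → G) ℂ) = 1 := by
  ext ψ c
  simp [localOp_apply, Matrix.one_apply, patch_restrict]

/-- The representation `M ↦ M ⊗ I` of the algebra of observables of `Λ`. -/
noncomputable def localRep (Λ : Finset Edge) :
    Matrix (Λ → G) (Λ → G) ℂ →⋆ₐ[ℂ] (HilbertSp G →L[ℂ] HilbertSp G) where
  toFun := localOp Λ
  map_one' := localOp_one Λ
  map_mul' := localOp_mul Λ
  map_zero' := by simpa using localOp_smul Λ 0 (0 : Matrix (Λ → G) (Λ → G) ℂ)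
  map_add' := localOp_add Λ
  commutes' z := by
    rw [Algebra.algebraMap_eq_smul_one, Algebra.algebraMap_eq_smul_one, localOp_smul, localOp_one]
  map_star' := localOp_star Λ

lemma localRep_apply (Λ : Finset Edge) (M : Matrix (Λ → G) (Λ → G) ℂ) (ψ : HilbertSp G)
    (c : Edge → G) :
    localRep Λ M ψ c = ∑ d : Λ → G, M (Λ.restrict c) d * ψ (patch c d) := rfl

lemma localRep_injective (Λ : Finset Edge) :
    Function.Injective (localRep (G := G) Λ) := by
  classical
  rw [injective_iff_map_eq_zero]
  intro M hM
  ext a b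
  have h := congrArg (fun T : HilbertSp G →L[ℂ] HilbertSp G =>
    T (lp.single 2 (patch 1 b) 1) (patch 1 a)) hM
  simp only [localRep_apply, restrict_patch, patch_patch] at h
  rw [Finset.sum_eq_single b] at h
  · simpa using h
  · intro d _ hd
    have : patch (1 : Edge → G) d ≠ patch 1 b := fun h' => hd (by
      rw [← restrict_patch (1 : Edge → G) d, h', restrict_patch])
    simp [lp.single_apply, this]
  · simp

open scoped Matrix.Norms.L2Operator in
/-- The representation of each local algebra is isometric for its C*-norm. -/
lemma norm_localRep (Λ : Finset Edge) (M : Matrix (Λ → G) (Λ → G) ℂ) :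
    ‖localRep Λ M‖ = ‖M‖ :=
  NonUnitalStarAlgHom.norm_map (localRep Λ) (localRep_injective Λ) M

/-- The inclusion `M ↦ M ⊗ I` of the observables of `Λ` into those of `Λ' ⊇ Λ`. -/
def inclusion {Λ Λ' : Finset Edge} (h : Λ ⊆ Λ') (M : Matrix (Λ → G) (Λ → G) ℂ) :
    Matrix (Λ' → G) (Λ' → G) ℂ :=
  fun a b => if ∀ e : Λ', (e : Edge) ∉ Λ → a e = b e then
    M (fun e => a ⟨e, h e.2⟩) (fun e => b ⟨e, h e.2⟩) else 0

lemma localRep_inclusion {Λ Λ' : Finset Edge} (h : Λ ⊆ Λ') (M : Matrix (Λ → G) (Λ → G) ℂ) :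
    localRep Λ' (inclusion h M) = localRep Λ M := by
  ext ψ c
  simp only [localRep_apply, inclusion, ite_mul, zero_mul]
  rw [← Finset.sum_filter]
  symm
  refine Finset.sum_bij (fun d _ => Λ'.restrict (patch c d)) ?_ ?_ ?_ ?_
  · intro d _
    simp only [Finset.mem_filter, Finset.mem_univ, true_and]
    intro e he
    simp [patch, he]
  · intro d _ d' _ hdd
    funext e
    have := congrFun hdd ⟨e, h e.2⟩
    simpa [patch] using this
  · intro b hb
    simp only [Finset.mem_filter, Finset.mem_univ, true_and] at hb
    refine ⟨fun e => b ⟨e, h e.2⟩, Finset.mem_univ _, ?_⟩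
    funext e
    by_cases he : (e : Edge) ∈ Λ
    · simp [patch, he]
    · simpa [patch, he] using hb e he
  · intro d _
    have h1 : (fun e : Λ => Λ'.restrict (patch c d) ⟨e, h e.2⟩) = d := by
      funext e; simp [patch]
    have h2 : patch c (Λ'.restrict (patch c d)) = patch c d := by
      funext e
      by_cases he : e ∈ Λ
      · simp [patch, he, h he]
      · by_cases he' : e ∈ Λ' <;> simp [patch, he, he']
    rw [h1, h2]
    rfl

lemma commute_localRep {Λ Λ' : Finset Edge} (h : Disjoint Λ Λ') (M : Matrix (Λ → G) (Λ → G) ℂ)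
    (N : Matrix (Λ' → G) (Λ' → G) ℂ) : Commute (localRep Λ M) (localRep Λ' N) := by
  have hr : ∀ {Λ Λ' : Finset Edge}, Disjoint Λ Λ' → ∀ (c : Edge → G) (d : Λ → G),
      Λ'.restrict (patch c d) = Λ'.restrict c := by
    intro Λ Λ' h c d
    funext e
    simp [patch, Finset.disjoint_right.1 h e.2]
  have hp : ∀ (c : Edge → G) (d : Λ → G) (d' : Λ' → G),
      patch (patch c d) d' = patch (patch c d') d := by
    intro c d d'
    funext e
    by_cases he : e ∈ Λ
    · simp [patch, he, Finset.disjoint_left.1 h he]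
    · simp [patch, he]
  change localRep Λ M * localRep Λ' N = localRep Λ' N * localRep Λ M
  ext ψ c
  simp only [mul_apply_eq_comp, localRep_apply, hr h, hr h.symm, Finset.mul_sum]
  rw [Finset.sum_comm]
  refine Finset.sum_congr rfl fun d' _ => Finset.sum_congr rfl fun d _ => ?_
  rw [hp]; ring

end Operators

section Algebra
variable (G : Type*) [CommGroup G] [Fintype G] [DecidableEq G]

/-- The algebra of local observables: the union over finite `Λ` of the algebras of `Λ`. -/
noncomputable def localAlgebra : StarSubalgebra ℂ (HilbertSp G →L[ℂ] HilbertSp G) where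
  carrier := {T | ∃ (Λ : Finset Edge) (M : Matrix (Λ → G) (Λ → G) ℂ), localRep Λ M = T}
  mul_mem' := by
    rintro _ _ ⟨Λ, M, rfl⟩ ⟨Λ', N, rfl⟩
    refine ⟨Λ ∪ Λ', inclusion Finset.subset_union_left M * inclusion Finset.subset_union_right N, ?_⟩
    rw [map_mul, localRep_inclusion, localRep_inclusion]
  add_mem' := by
    rintro _ _ ⟨Λ, M, rfl⟩ ⟨Λ', N, rfl⟩
    refine ⟨Λ ∪ Λ', inclusion Finset.subset_union_left M + inclusion Finset.subset_union_right N, ?_⟩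
    rw [map_add, localRep_inclusion, localRep_inclusion]
  algebraMap_mem' z := ⟨∅, algebraMap ℂ _ z, AlgHomClass.commutes _ z⟩
  star_mem' := by
    rintro _ ⟨Λ, M, rfl⟩
    exact ⟨Λ, star M, map_star _ _⟩

/-- The quasi-local algebra: the norm closure of the algebra of local observables. -/
noncomputable def quasiLocalAlgebra : StarSubalgebra ℂ (HilbertSp G →L[ℂ] HilbertSp G) :=
  (localAlgebra G).topologicalClosure

instance isClosed_quasiLocalAlgebra :
    IsClosed (quasiLocalAlgebra G : Set (HilbertSp G →L[ℂ] HilbertSp G)) :=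
  (localAlgebra G).isClosed_topologicalClosure

/-- Elements of the quasi-local algebra (a unital C*-algebra). -/
abbrev Observable : Type _ := ↥(quasiLocalAlgebra G)

/-- The embedding of the algebra of observables of `Λ` into the quasi-local algebra. -/
noncomputable def localObs (Λ : Finset Edge) :
    Matrix (Λ → G) (Λ → G) ℂ →⋆ₐ[ℂ] Observable G :=
  (localRep Λ).codRestrict (quasiLocalAlgebra G) fun M =>
    (localAlgebra G).le_topologicalClosure ⟨Λ, M, rfl⟩

/-- `A` is a local observable. -/
def IsLocal (A : Observable G) : Prop :=
  ∃ (Λ : Finset Edge) (M : Matrix (Λ → G) (Λ → G) ℂ), localObs G Λ M = A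

end Algebra

section Model

/-! ### The model -/

/-- Starting point of an edge. -/
def edgeSource (e : Edge) : Vertex := e.1

/-- End point of an edge. -/
def edgeTarget (e : Edge) : Vertex := if e.2 then e.1 + (0, 1) else e.1 + (1, 0)

/-- The star at `v`: the four edges sharing `v`. -/
def starEdges (v : Vertex) : Finset Edge :=
  {(v, false), (v, true), (v - (1, 0), false), (v - (0, 1), true)}

lemma mem_starEdges (v : Vertex) (e : Edge) :
    e ∈ starEdges v ↔ edgeSource e = v ∨ edgeTarget e = v := by
  obtain ⟨w, b⟩ := e
  cases b <;> simp [starEdges, edgeSource, edgeTarget, eq_sub_iff_add_eq]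

/-- The plaquette `f`: its left, top, right and bottom edges (in clockwise order). -/
def plaquetteEdges (f : Vertex) : Finset Edge :=
  {(f, true), (f + (0, 1), false), (f + (1, 0), true), (f, false)}

/-- The square `Λ_L` of all edges in `[-L, L]²`. -/
noncomputable def box (L : ℕ) : Finset Edge :=
  (((Finset.Icc (-(L : ℤ)) L ×ˢ Finset.Icc (-(L : ℤ)) L) ×ˢ Finset.univ)).filter
    fun e => edgeTarget e ∈ Finset.Icc (-(L : ℤ)) L ×ˢ Finset.Icc (-(L : ℤ)) L

/-- The stars contained in `Λ`. -/
def starsIn (Λ : Finset Edge) : Finset Vertex :=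
  (Λ.image edgeSource).filter fun v => starEdges v ⊆ Λ

/-- The plaquettes contained in `Λ`. -/
def plaquettesIn (Λ : Finset Edge) : Finset Vertex :=
  (Λ.image edgeSource).filter fun f => plaquetteEdges f ⊆ Λ

lemma mem_starsIn (Λ : Finset Edge) (v : Vertex) : v ∈ starsIn Λ ↔ starEdges v ⊆ Λ := by
  simp only [starsIn, Finset.mem_filter, and_iff_right_iff_imp]
  intro h
  exact Finset.mem_image.2 ⟨(v, false), h (by simp [starEdges]), rfl⟩

lemma mem_plaquettesIn (Λ : Finset Edge) (f : Vertex) :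
    f ∈ plaquettesIn Λ ↔ plaquetteEdges f ⊆ Λ := by
  simp only [plaquettesIn, Finset.mem_filter, and_iff_right_iff_imp]
  intro h
  exact Finset.mem_image.2 ⟨(f, false), h (by simp [plaquetteEdges]), rfl⟩

lemma mem_box (L : ℕ) (e : Edge) : e ∈ box L ↔
    (-(L : ℤ) ≤ e.1.1 ∧ e.1.1 ≤ L ∧ -(L : ℤ) ≤ e.1.2 ∧ e.1.2 ≤ L) ∧
      (if e.2 then e.1.2 + 1 ≤ L else e.1.1 + 1 ≤ L) := by
  obtain ⟨⟨x, y⟩, b⟩ := e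
  cases b <;> simp [box, edgeTarget] <;> omega

variable {G : Type*} [CommGroup G] [Fintype G] [DecidableEq G]

/-- The gauge transformation by `g` at the single vertex `v`: values on edges starting at `v` are
multiplied by `g` on the left, values on edges ending at `v` by `g⁻¹` on the right. -/
def gauge (v : Vertex) (g : G) (b : starEdges v → G) : starEdges v → G :=
  fun e => if edgeSource e = v then g * b e else b e * g⁻¹

/-- The star operator `A_v^g`, mapping the basis vector of `b` to that of `gauge v g b`. -/
noncomputable def starOp (v : Vertex) (g : G) : Observable G :=
  localObs G (starEdges v) (Matrix.of fun a b => if a = gauge v g b then 1 else 0)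

/-- The monodromy around `f`, with edges taken clockwise. -/
def monodromy (f : Vertex) (b : plaquetteEdges f → G) : G :=
  b ⟨(f, true), by simp [plaquetteEdges]⟩ * b ⟨(f + (0, 1), false), by simp [plaquetteEdges]⟩ *
    (b ⟨(f + (1, 0), true), by simp [plaquetteEdges]⟩)⁻¹ *
    (b ⟨(f, false), by simp [plaquetteEdges]⟩)⁻¹

/-- The plaquette operator `B_f^h`, projecting onto configurations with monodromy `h` around `f`. -/
noncomputable def plaquetteOp (f : Vertex) (h : G) : Observable G :=
  localObs G (plaquetteEdges f) (Matrix.diagonal fun b => if monodromy f b = h then 1 else 0)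

/-- `A_v = |G|⁻¹ ∑_g A_v^g`. -/
noncomputable def starTerm (G : Type*) [CommGroup G] [Fintype G] [DecidableEq G] (v : Vertex) :
    Observable G :=
  (Fintype.card G : ℂ)⁻¹ • ∑ g : G, starOp v g

/-- `B_f = B_f^e`. -/
noncomputable def plaquetteTerm (G : Type*) [CommGroup G] [Fintype G] [DecidableEq G]
    (f : Vertex) : Observable G := plaquetteOp f (1 : G)

/-- The local Hamiltonian `H_Λ`. -/
noncomputable def hamiltonian (G : Type*) [CommGroup G] [Fintype G] [DecidableEq G]
    (Λ : Finset Edge) : Observable G :=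
  ∑ v ∈ starsIn Λ, (1 - starTerm G v) + ∑ f ∈ plaquettesIn Λ, (1 - plaquetteTerm G f)

/-- The generator of the dynamics on local observables, `δ(A) = lim_L [H_L, A]`; for local `A` the
limit exists by `tendsto_derivation`. -/
noncomputable def derivation (A : Observable G) : Observable G :=
  limUnder atTop fun L : ℕ => hamiltonian G (box L) * A - A * hamiltonian G (box L)

lemma commute_localObs {Λ Λ' : Finset Edge} (h : Disjoint Λ Λ') (M : Matrix (Λ → G) (Λ → G) ℂ)
    (N : Matrix (Λ' → G) (Λ' → G) ℂ) : Commute (localObs G Λ M) (localObs G Λ' N) :=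
  Subtype.ext (commute_localRep h M N)

lemma exists_box (Λ : Finset Edge) : ∃ R : ℕ, Λ ⊆ box R := by
  induction Λ using Finset.induction_on with
  | empty => exact ⟨0, by simp⟩
  | insert e Λ _ ih =>
    obtain ⟨R, hR⟩ := ih
    refine ⟨R + (e.1.1.natAbs + e.1.2.natAbs + 1), Finset.insert_subset ?_ fun e' he' => ?_⟩
    · rw [mem_box]; split_ifs <;> omega
    · have := hR he'
      rw [mem_box] at this ⊢
      split_ifs at this ⊢ <;> omega

lemma box_mono {R L : ℕ} (h : R ≤ L) : box R ⊆ box L := by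
  intro e he
  rw [mem_box] at he ⊢
  split_ifs at he ⊢ <;> omega

lemma star_local {R : ℕ} {v : Vertex} (h : ¬ Disjoint (starEdges v) (box R)) :
    starEdges v ⊆ box (R + 1) := by
  obtain ⟨e, he, he'⟩ := Finset.not_disjoint_iff.1 h
  obtain ⟨x, y⟩ := v
  rw [mem_box] at he'
  intro e' h'
  rw [mem_box]
  simp only [starEdges, Finset.mem_insert, Finset.mem_singleton] at he h'
  rcases he with rfl | rfl | rfl | rfl <;> rcases h' with rfl | rfl | rfl | rfl <;>
    simp at he' ⊢ <;> omega

lemma plaquette_local {R : ℕ} {v : Vertex} (h : ¬ Disjoint (plaquetteEdges v) (box R)) :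
    plaquetteEdges v ⊆ box (R + 1) := by
  obtain ⟨e, he, he'⟩ := Finset.not_disjoint_iff.1 h
  obtain ⟨x, y⟩ := v
  rw [mem_box] at he'
  intro e' h'
  rw [mem_box]
  simp only [plaquetteEdges, Finset.mem_insert, Finset.mem_singleton] at he h'
  rcases he with rfl | rfl | rfl | rfl <;> rcases h' with rfl | rfl | rfl | rfl <;>
    simp at he' ⊢ <;> omega

lemma commutator_eq {Λ : Finset Edge} {R L : ℕ} (hΛ : Λ ⊆ box R) (hL : R + 1 ≤ L)
    (M : Matrix (Λ → G) (Λ → G) ℂ) :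
    hamiltonian G (box L) * localObs G Λ M - localObs G Λ M * hamiltonian G (box L) =
      hamiltonian G (box (R + 1)) * localObs G Λ M -
        localObs G Λ M * hamiltonian G (box (R + 1)) := by
  have hS : ∑ v ∈ starsIn (box (R + 1)),
      ((1 - starTerm G v) * localObs G Λ M - localObs G Λ M * (1 - starTerm G v)) =
      ∑ v ∈ starsIn (box L),
      ((1 - starTerm G v) * localObs G Λ M - localObs G Λ M * (1 - starTerm G v)) := by
    refine Finset.sum_subset (fun v hv => ?_) fun v _ hv => ?_
    · rw [mem_starsIn] at hv ⊢
      exact hv.trans (box_mono hL)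
    · rw [mem_starsIn] at hv
      have hd : Disjoint (starEdges v) Λ :=
        (not_not.1 fun h => hv (star_local h)).mono_right hΛ
      refine sub_eq_zero.2 (((Commute.one_left _).sub_left ?_).eq)
      exact (Commute.sum_left _ _ _ fun g _ => commute_localObs hd _ _).smul_left _
  have hP : ∑ f ∈ plaquettesIn (box (R + 1)),
      ((1 - plaquetteTerm G f) * localObs G Λ M - localObs G Λ M * (1 - plaquetteTerm G f)) =
      ∑ f ∈ plaquettesIn (box L),
      ((1 - plaquetteTerm G f) * localObs G Λ M - localObs G Λ M * (1 - plaquetteTerm G f)) := by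
    refine Finset.sum_subset (fun v hv => ?_) fun v _ hv => ?_
    · rw [mem_plaquettesIn] at hv ⊢
      exact hv.trans (box_mono hL)
    · rw [mem_plaquettesIn] at hv
      have hd : Disjoint (plaquetteEdges v) Λ :=
        (not_not.1 fun h => hv (plaquette_local h)).mono_right hΛ
      exact sub_eq_zero.2 (((Commute.one_left _).sub_left (commute_localObs hd _ _)).eq)
  rw [Finset.sum_sub_distrib, Finset.sum_sub_distrib] at hS hP
  simp only [hamiltonian, add_mul, mul_add, Finset.sum_mul, Finset.mul_sum]
  rw [add_sub_add_comm, add_sub_add_comm, ← hS, ← hP]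

/-- The norm limit defining `δ(A)` exists for every local observable `A`. -/
lemma tendsto_derivation {A : Observable G} (hA : IsLocal G A) :
    Tendsto (fun L : ℕ => hamiltonian G (box L) * A - A * hamiltonian G (box L)) atTop
      (𝓝 (derivation A)) := by
  obtain ⟨Λ, M, rfl⟩ := hA
  obtain ⟨R, hR⟩ := exists_box Λ
  refine tendsto_nhds_limUnder ⟨hamiltonian G (box (R + 1)) * localObs G Λ M -
      localObs G Λ M * hamiltonian G (box (R + 1)), ?_⟩
  refine tendsto_const_nhds.congr' ?_
  filter_upwards [eventually_ge_atTop (R + 1)] with L hL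
  exact (commutator_eq hR hL M).symm

/-! ### Charges -/

/-- The dual group of the finite abelian group `G`. -/
abbrev Character (G : Type*) [CommGroup G] : Type _ := G →* ℂˣ

noncomputable instance fintypeCharacter (G : Type*) [CommGroup G] [Fintype G] :
    Fintype (Character G) := Fintype.ofFinite _

/-- `D_v^χ = |G|⁻¹ ∑_g conj (χ g) A_v^g`. -/
noncomputable def starProj (v : Vertex) (χ : Character G) : Observable G :=
  (Fintype.card G : ℂ)⁻¹ • ∑ g : G, conj (χ g : ℂ) • starOp v g

/-- `D_f^c = B_f^c`. -/
noncomputable def plaquetteProj (f : Vertex) (c : G) : Observable G := plaquetteOp f c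

lemma gauge_gauge (v : Vertex) (g : G) (b : starEdges v → G) : gauge v g⁻¹ (gauge v g b) = b := by
  funext e; simp only [gauge]; split_ifs <;> simp

lemma starOp_apply (v : Vertex) (g : G) (ψ : HilbertSp G) (c : Edge → G) :
    (starOp v g : HilbertSp G →L[ℂ] HilbertSp G) ψ c =
      ψ (patch c (gauge v g⁻¹ ((starEdges v).restrict c))) := by
  change localRep (starEdges v) _ ψ c = _
  rw [localRep_apply, Finset.sum_eq_single (gauge v g⁻¹ ((starEdges v).restrict c))]
  · have := gauge_gauge v g⁻¹ ((starEdges v).restrict c)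
    rw [inv_inv] at this
    simp [this]
  · intro d _ hd
    have : (starEdges v).restrict c ≠ gauge v g d := fun h => hd (by rw [h, gauge_gauge])
    simp [this]
  · simp

lemma plaquetteOp_apply (f : Vertex) (h : G) (ψ : HilbertSp G) (c : Edge → G) :
    (plaquetteOp f h : HilbertSp G →L[ℂ] HilbertSp G) ψ c =
      if monodromy f ((plaquetteEdges f).restrict c) = h then ψ c else 0 := by
  change localRep (plaquetteEdges f) _ ψ c = _
  simp [localRep_apply, Matrix.diagonal_apply, patch_restrict]

lemma commute_starOp (v w : Vertex) (g h : G) : Commute (starOp v g) (starOp w h) := by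
  apply Subtype.ext
  change (starOp v g : HilbertSp G →L[ℂ] HilbertSp G) * (starOp w h : HilbertSp G →L[ℂ] HilbertSp G)
    = (starOp w h : HilbertSp G →L[ℂ] HilbertSp G) * (starOp v g : HilbertSp G →L[ℂ] HilbertSp G)
  ext ψ c
  simp only [mul_apply_eq_comp, starOp_apply]
  refine congrArg (fun b : Edge → G => ψ b) ?_
  funext e
  by_cases hv : e ∈ starEdges v <;> by_cases hw : e ∈ starEdges w <;>
    simp only [patch, hv, hw, dite_true, dite_false, gauge, Finset.restrict] <;>
    split_ifs <;> ac_rfl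

lemma commute_starProj (v w : Vertex) (χ ξ : Character G) :
    Commute (starProj v χ) (starProj w ξ) := by
  refine Commute.smul_left (Commute.smul_right ?_ _) _
  exact Commute.sum_left _ _ _ fun g _ => Commute.sum_right _ _ _ fun h _ =>
    ((commute_starOp v w g h).smul_left _).smul_right _

lemma commute_plaquetteProj (f f' : Vertex) (c d : G) :
    Commute (plaquetteProj f c) (plaquetteProj f' d) := by
  apply Subtype.ext
  change (plaquetteOp f c : HilbertSp G →L[ℂ] HilbertSp G) *
      (plaquetteOp f' d : HilbertSp G →L[ℂ] HilbertSp G)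
    = (plaquetteOp f' d : HilbertSp G →L[ℂ] HilbertSp G) *
      (plaquetteOp f c : HilbertSp G →L[ℂ] HilbertSp G)
  ext ψ b
  simp only [mul_apply_eq_comp, plaquetteOp_apply]
  split_ifs <;> rfl

open Classical in
/-- `D_L^χ`: the sum, over all assignments of characters to the stars in `Λ_L` with product `χ`, of
the product of the corresponding local charge projectors. -/
noncomputable def electricProj (L : ℕ) (χ : Character G) : Observable G :=
  ∑ x : starsIn (box L) → Character G with ∏ v : starsIn (box L), x v = χ,
    Finset.univ.noncommProd (fun v : starsIn (box L) => starProj (v : Vertex) (x v))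
      fun _ _ _ _ _ => commute_starProj _ _ _ _

/-- `D_L^c`: the sum, over all assignments of group elements to the plaquettes in `Λ_L` with product
`c`, of the product of the corresponding local charge projectors. -/
noncomputable def magneticProj (L : ℕ) (c : G) : Observable G :=
  ∑ x : plaquettesIn (box L) → G with ∏ f : plaquettesIn (box L), x f = c,
    Finset.univ.noncommProd (fun f : plaquettesIn (box L) => plaquetteProj (f : Vertex) (x f))
      fun _ _ _ _ _ => commute_plaquetteProj _ _ _ _

/-- The global charge projector `D_L^{χ,c} = D_L^χ D_L^c`. -/
noncomputable def chargeProj (L : ℕ) (χ : Character G) (c : G) : Observable G :=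
  electricProj L χ * magneticProj L c

/-- States: positive linear functionals with value `1` at the unit. -/
def states (G : Type*) [CommGroup G] [Fintype G] [DecidableEq G] : Set (Observable G →ₗ[ℂ] ℂ) :=
  {ω | (∀ A : Observable G, 0 ≤ ω (star A * A)) ∧ ω 1 = 1}

/-- Pure states: the extremal points of the set of states. -/
def pureStates (G : Type*) [CommGroup G] [Fintype G] [DecidableEq G] :
    Set (Observable G →ₗ[ℂ] ℂ) :=
  (states G).extremePoints ℝ

/-- The set `K` of infinite volume ground states. -/
def groundStates (G : Type*) [CommGroup G] [Fintype G] [DecidableEq G] :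
    Set (Observable G →ₗ[ℂ] ℂ) :=
  {ω | ω ∈ states G ∧ ∀ A : Observable G, IsLocal G A → 0 ≤ ω (star A * derivation A)}

/-- The set `K^{χ,c}` of ground states of charge `(χ, c)`. -/
def chargedGroundStates (χ : Character G) (c : G) : Set (Observable G →ₗ[ℂ] ℂ) :=
  {φ | φ ∈ states G ∧ ∃ ω ∈ groundStates G,
    (∃ r : ℝ, 0 < r ∧ Tendsto (fun L : ℕ => ω (chargeProj L χ c)) atTop (𝓝 (r : ℂ))) ∧
    ∀ A : Observable G,
      Tendsto (fun L : ℕ => ω (A * chargeProj L χ c) / ω (chargeProj L χ c)) atTop (𝓝 (φ A))}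

/-- `F` is a face of the convex set `S` (no closedness required). -/
structure IsFace {E : Type*} [AddCommGroup E] [Module ℝ E] (S F : Set E) : Prop where
  convex : Convex ℝ F
  isExtreme : IsExtreme ℝ S F

end Model

end QuantumDouble

/-!
A ground state is characterized by null vectors, and so is its charge; both conditions pass from a
convex combination of states to its terms, which is the face property.

*Ground states.* The local Hamiltonian is a sum of commuting projections, so its adjoint action on
local observables is diagonalizable with integer eigenvalues
(`exists_eigen_decomposition_of_isLocal`). Expanding `A` in `ω (A⋆ δ(A))` into eigenoperators shows
that a state `ω` is a ground state if and only if `ω (B⋆ B) = 0` for every local `B` which lowers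
the energy, `δ(B) = k B` with `k < 0` (`mem_groundStates_iff`); the cross terms vanish by the
Cauchy–Schwarz inequality. As `ω (B⋆ B) ≥ 0` for all states, the ground states form a face.

*At most one charge of each type.* Two charged stars `v`, `w` can be fused by a string operator,
which carries the charge of `w` to `v` and commutes with the plaquette terms. This lowers the
energy, so a ground state vanishes on `D_v^χ D_w^ξ` for nontrivial `χ`, `ξ`; likewise for plaquettes
(`map_mul_eq_zero_of_transports`). String operators are products of single edge operators, so it is
enough to know how these act on the charges.

*Total charges.* All charge projections lie in a commutative star algebra, on which a ground state
is a probability distribution of charges. As there is at most one charge of each type, a nontrivial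
total charge of a box is also that of every larger box. Hence the total charge stabilizes, with the
uniform bound `exists_tendsto_zero_bound_chargeProj`. It follows that the states of charge `(χ, c)`
are the ground states `φ` with `φ (D_L^{χ,c}) → 1` (`mem_chargedGroundStates_iff`): conditioning a
ground state on the charge produces such a state, and such a state is its own conditioning. Since
`φ (D_L^{χ,c}) ≤ 1` for all states, the limit `1` is inherited by the terms of a convex combination.
-/

namespace QuantumDouble

/-! ### Positive functionals -/

section Positive

variable {R : Type*} [Ring R] [StarRing R] [Algebra ℂ R] [StarModule ℂ R] {ω : R →ₗ[ℂ] ℂ}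

lemma conj_map_star_mul_of_nonneg (hω : ∀ A, 0 ≤ ω (star A * A)) (A B : R) :
    conj (ω (star B * A)) = ω (star A * B) := by
  have him : ∀ X, (ω (star X * X)).im = 0 := fun X => (Complex.nonneg_iff.1 (hω X)).2.symm
  have h1 := him (A + B)
  have h2 := him (A + Complex.I • B)
  simp only [star_add, star_smul, add_mul, mul_add, map_add, Complex.add_im, him, smul_mul_assoc,
    mul_smul_comm, map_smul, smul_eq_mul, Complex.mul_im, Complex.mul_re, RCLike.star_def,
    Complex.conj_I, Complex.neg_re, Complex.neg_im, Complex.I_re, Complex.I_im] at h1 h2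
  apply Complex.ext
  · rw [Complex.conj_re]; linarith
  · rw [Complex.conj_im]; linarith

/-- The Cauchy–Schwarz inequality for the sesquilinear form `ω (A⋆ B)`. -/
lemma norm_map_star_mul_sq_le (hω : ∀ A, 0 ≤ ω (star A * A)) (A B : R) :
    ‖ω (star A * B)‖ ^ 2 ≤ (ω (star A * A)).re * (ω (star B * B)).re := by
  let c : PreInnerProductSpace.Core ℂ R :=
    { inner := fun x y => ω (star x * y)
      conj_inner_symm := fun x y => conj_map_star_mul_of_nonneg hω x y
      re_inner_nonneg := fun x => (Complex.nonneg_iff.1 (hω x)).1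
      add_left := fun x y z => by simp [add_mul]
      smul_left := fun x y r => by simp }
  have h := InnerProductSpace.Core.inner_mul_inner_self_le (𝕜 := ℂ) A B
  have h2 : ‖ω (star B * A)‖ = ‖ω (star A * B)‖ := by
    rw [← conj_map_star_mul_of_nonneg hω A B, RCLike.norm_conj]
  change ‖ω (star A * B)‖ * ‖ω (star B * A)‖ ≤ (ω (star A * A)).re * (ω (star B * B)).re at h
  rwa [h2, ← sq] at h

lemma map_mul_eq_zero_of_null (hω : ∀ A, 0 ≤ ω (star A * A)) {B : R} (hB : ω (star B * B) = 0)
    (A : R) : ω (A * B) = 0 := by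
  have h := norm_map_star_mul_sq_le hω (star A) B
  rw [hB, star_star] at h
  simpa using h

lemma map_star_mul_eq_zero_of_null (hω : ∀ A, 0 ≤ ω (star A * A)) {B : R}
    (hB : ω (star B * B) = 0) (A : R) : ω (star B * A) = 0 := by
  rw [← conj_map_star_mul_of_nonneg hω, map_mul_eq_zero_of_null hω hB, map_zero]

end Positive

/-! ### Eigenoperators of a sum of commuting idempotents -/

section Eigen

variable {R : Type*} [Ring R] [Algebra ℂ R]

/-- The elements `B` of `S` with `[H, B] = k B`. -/
def eigenOperators (S : Subalgebra ℂ R) (H : R) (k : ℤ) : Submodule ℂ R where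
  carrier := {B | B ∈ S ∧ H * B - B * H = (k : ℂ) • B}
  add_mem' := by
    rintro a b ⟨ha, ha'⟩ ⟨hb, hb'⟩
    refine ⟨S.add_mem ha hb, ?_⟩
    rw [smul_add, ← ha', ← hb']; noncomm_ring
  zero_mem' := ⟨S.zero_mem, by simp⟩
  smul_mem' := by
    rintro z a ⟨ha, ha'⟩
    refine ⟨S.smul_mem ha z, ?_⟩
    rw [smul_comm, ← ha', mul_smul_comm, smul_mul_assoc, smul_sub]

lemma mul_mem_eigenOperators {S : Subalgebra ℂ R} {H A B : R} {j k : ℤ}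
    (hA : A ∈ eigenOperators S H j) (hB : B ∈ eigenOperators S H k) :
    A * B ∈ eigenOperators S H (j + k) := by
  refine ⟨S.mul_mem hA.1 hB.1, ?_⟩
  have h : H * (A * B) - A * B * H = (H * A - A * H) * B + A * (H * B - B * H) := by noncomm_ring
  rw [h, hA.2, hB.2, smul_mul_assoc, mul_smul_comm, ← add_smul, Int.cast_add]

/-- Splitting `B` into its four blocks with respect to an idempotent `p` commuting with `H` turns an
eigenoperator of `H` into a sum of eigenoperators of `H + p`. -/
lemma mem_iSup_eigenOperators_add {S : Subalgebra ℂ R} {H p B : R} {k : ℤ} (hp : p * p = p)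
    (hpS : p ∈ S) (hpH : Commute p H) (hB : B ∈ eigenOperators S H k) :
    B ∈ ⨆ j, eigenOperators S (p + H) j := by
  obtain ⟨hBS, hB⟩ := hB
  have hq : ∀ q r : R, q ∈ S → r ∈ S → Commute q H → Commute r H → ∀ a : ℤ,
      p * (q * B * r) - q * B * r * p = (a : ℂ) • (q * B * r) →
      q * B * r ∈ ⨆ j, eigenOperators S (p + H) j := by
    intro q r hqS hrS hqH hrH a ha
    refine Submodule.mem_iSup_of_mem (a + k) ⟨S.mul_mem (S.mul_mem hqS hBS) hrS, ?_⟩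
    have h1 : H * (q * B * r) - q * B * r * H = (k : ℂ) • (q * B * r) := by
      have : H * (q * B * r) - q * B * r * H = q * (H * B - B * H) * r := by
        have e1 : H * (q * B * r) = q * (H * B) * r := by
          rw [mul_assoc q B r, ← mul_assoc H q, ← hqH.eq]; simp only [mul_assoc]
        have e2 : q * B * r * H = q * (B * H) * r := by
          rw [mul_assoc (q * B) r H, hrH.eq]; simp only [mul_assoc]
        rw [e1, e2]; noncomm_ring
      rw [this, hB]; simp
    rw [Int.cast_add, add_smul, ← ha, ← h1]; noncomm_ring
  have hS' : 1 - p ∈ S := S.sub_mem S.one_mem hpS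
  have hH' : Commute (1 - p) H := (Commute.one_left H).sub_left hpH
  have h0 : p * (1 - p) = 0 := by rw [mul_sub, hp, mul_one, sub_self]
  have h0' : (1 - p) * p = 0 := by rw [sub_mul, hp, one_mul, sub_self]
  have hsum : B = p * B * p + p * B * (1 - p) + (1 - p) * B * p + (1 - p) * B * (1 - p) := by
    noncomm_ring
  rw [hsum]
  refine Submodule.add_mem _ (Submodule.add_mem _ (Submodule.add_mem _ ?_ ?_) ?_) ?_
  · refine hq p p hpS hpS hpH hpH 0 ?_
    rw [mul_assoc (p * B) p p, hp, mul_assoc p B p, ← mul_assoc p p, hp]; simp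
  · refine hq p (1 - p) hpS hS' hpH hH' 1 ?_
    rw [mul_assoc (p * B) (1 - p) p, h0', mul_assoc p B (1 - p), ← mul_assoc p p, hp]; simp
  · refine hq (1 - p) p hS' hpS hH' hpH (-1) ?_
    rw [mul_assoc ((1 - p) * B) p p, hp, mul_assoc (1 - p) B p, ← mul_assoc p (1 - p), h0]; simp
  · refine hq (1 - p) (1 - p) hS' hS' hH' hH' 0 ?_
    rw [mul_assoc ((1 - p) * B) (1 - p) p, h0', mul_assoc (1 - p) B (1 - p), ← mul_assoc p (1 - p),
      h0]; simp

/-- A sum of commuting idempotents has an adjoint action which is diagonalizable, with integer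
eigenvalues. -/
lemma mem_iSup_eigenOperators_sum {ι : Type*} (s : Finset ι) (p : ι → R) {S : Subalgebra ℂ R}
    (hp : ∀ i ∈ s, p i * p i = p i) (hpS : ∀ i ∈ s, p i ∈ S)
    (hcomm : ∀ i ∈ s, ∀ j ∈ s, Commute (p i) (p j)) {A : R} (hA : A ∈ S) :
    A ∈ ⨆ k, eigenOperators S (∑ i ∈ s, p i) k := by
  classical
  induction s using Finset.induction_on with
  | empty => exact Submodule.mem_iSup_of_mem 0 ⟨hA, by simp⟩
  | insert i s hi ih =>
    rw [Finset.sum_insert hi]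
    have h := ih (fun j hj => hp j (Finset.mem_insert_of_mem hj))
      (fun j hj => hpS j (Finset.mem_insert_of_mem hj))
      (fun j hj l hl => hcomm j (Finset.mem_insert_of_mem hj) l (Finset.mem_insert_of_mem hl))
    have hi' := Finset.mem_insert_self i s
    have hle : ⨆ k, eigenOperators S (∑ j ∈ s, p j) k ≤
        ⨆ k, eigenOperators S (p i + ∑ j ∈ s, p j) k :=
      iSup_le fun k B hB => mem_iSup_eigenOperators_add (hp i hi') (hpS i hi')
        (Commute.sum_right _ _ _ fun j hj => hcomm i hi' j (Finset.mem_insert_of_mem hj)) hB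
    exact hle h

lemma exists_eigen_decomposition {S : Subalgebra ℂ R} {H A : R}
    (hA : A ∈ ⨆ k, eigenOperators S H k) :
    ∃ (t : Finset ℤ) (f : ℤ → R), (∀ k, f k ∈ eigenOperators S H k) ∧ A = ∑ k ∈ t, f k := by
  obtain ⟨f, hf, rfl⟩ := (Submodule.mem_iSup_iff_exists_finsupp _ _).1 hA
  exact ⟨f.support, f, hf, rfl⟩

end Eigen

/-! ### Total charges of a commuting family of charge projections -/

section Charges

variable {C : Type*} [CommRing C] [StarRing C] {ι Q : Type*}

/-- A family of projections `p v q`, "the charge at the site `v` is `q`", which for each site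
form an orthogonal decomposition of the unit. -/
structure IsChargeFamily {R : Type*} [Ring R] [StarRing R] [Fintype Q] (p : ι → Q → R) : Prop where
  star_eq : ∀ v q, star (p v q) = p v q
  mul_self : ∀ v q, p v q * p v q = p v q
  mul_of_ne : ∀ v q q', q ≠ q' → p v q * p v q' = 0
  sum_eq_one : ∀ v, ∑ q, p v q = 1

lemma IsChargeFamily.of_injective [Fintype Q] {R : Type*} [Ring R] [StarRing R] [Algebra ℂ R]
    [Algebra ℂ C] {p : ι → Q → C} {p' : ι → Q → R} (hp' : IsChargeFamily p') (j : C →⋆ₐ[ℂ] R)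
    (hj : Function.Injective j) (h : ∀ v q, j (p v q) = p' v q) : IsChargeFamily p where
  star_eq v q := hj (by rw [map_star, h, hp'.star_eq])
  mul_self v q := hj (by rw [map_mul, h, hp'.mul_self])
  mul_of_ne v q q' hq := hj (by rw [map_mul, h, h, hp'.mul_of_ne v q q' hq, map_zero])
  sum_eq_one v := hj (by simp only [map_sum, h, hp'.sum_eq_one, map_one])

lemma IsChargeFamily.prod_mul_prod {p : ι → Q → C} {s t : Finset ι}
    [Fintype Q] (hp : IsChargeFamily p) {x : s → Q} {y : t → Q} {v : ι}
    (hs : v ∈ s) (ht : v ∈ t) (hne : x ⟨v, hs⟩ ≠ y ⟨v, ht⟩) :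
    (∏ w : s, p w (x w)) * ∏ w : t, p w (y w) = 0 := by
  have h1 : p v (x ⟨v, hs⟩) ∣ ∏ w : s, p w (x w) :=
    Finset.dvd_prod_of_mem (fun w : s => p w (x w)) (Finset.mem_univ ⟨v, hs⟩)
  have h2 : p v (y ⟨v, ht⟩) ∣ ∏ w : t, p w (y w) :=
    Finset.dvd_prod_of_mem (fun w : t => p w (y w)) (Finset.mem_univ ⟨v, ht⟩)
  have h := mul_dvd_mul h1 h2
  rwa [hp.mul_of_ne _ _ _ hne, zero_dvd_iff] at h

section Total

variable [CommGroup Q] [Fintype Q]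

open Classical in
/-- The projection onto total charge `q` in the finite set `s` of sites. -/
noncomputable def totalCharge (p : ι → Q → C) (s : Finset ι) (q : Q) : C :=
  ∑ x : s → Q with ∏ v, x v = q, ∏ v : s, p v (x v)

variable {p : ι → Q → C} {s t : Finset ι}

lemma map_totalCharge {R : Type*} [Ring R] [StarRing R] [Algebra ℂ R] [Algebra ℂ C]
    (j : C →⋆ₐ[ℂ] R) {p' : ι → Q → R} (h : ∀ v q, j (p v q) = p' v q) {s : Finset ι} {q : Q}
    [Fintype (s → Q)] [DecidablePred fun x : s → Q => ∏ v, x v = q]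
    (hc : ∀ x : s → Q, ((Finset.univ : Finset s) : Set s).Pairwise
      (Function.onFun Commute fun v : s => p' v (x v))) :
    j (totalCharge p s q) = ∑ x : s → Q with ∏ v, x v = q,
      Finset.univ.noncommProd (fun v : s => p' v (x v)) (hc x) := by
  rw [totalCharge, map_sum]
  refine Finset.sum_congr (by congr!) fun x _ => ?_
  rw [← Finset.noncommProd_eq_prod]
  exact (Finset.map_noncommProd _ _ (fun _ _ _ _ _ => Commute.all _ _) j).trans
    (Finset.noncommProd_congr rfl (fun (v : s) _ => h v (x v)) _)

lemma IsChargeFamily.star_totalCharge (hp : IsChargeFamily p) (s : Finset ι) (q : Q) :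
    star (totalCharge p s q) = totalCharge p s q := by
  simp [totalCharge, star_sum, star_prod, hp.star_eq]

lemma IsChargeFamily.totalCharge_mul_of_ne (hp : IsChargeFamily p) (s : Finset ι) {q q' : Q}
    (h : q ≠ q') : totalCharge p s q * totalCharge p s q' = 0 := by
  rw [totalCharge, totalCharge, Finset.sum_mul_sum]
  refine Finset.sum_eq_zero fun x hx => Finset.sum_eq_zero fun y hy => ?_
  simp only [Finset.mem_filter, Finset.mem_univ, true_and] at hx hy
  have hxy : x ≠ y := by rintro rfl; exact h (hx ▸ hy)
  obtain ⟨v, hv⟩ := Function.ne_iff.1 hxy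
  exact hp.prod_mul_prod v.2 v.2 hv

lemma IsChargeFamily.sum_totalCharge (hp : IsChargeFamily p) (s : Finset ι) :
    ∑ q, totalCharge p s q = 1 := by
  classical
  have h1 : ∑ q, totalCharge p s q = ∑ x : s → Q, ∏ v : s, p v (x v) := by
    have := Finset.sum_fiberwise (Finset.univ : Finset (s → Q)) (fun x => ∏ v, x v)
      (fun x => ∏ v : s, p v (x v))
    rw [← this]
    refine Finset.sum_congr rfl fun q _ => ?_
    rw [totalCharge]
  rw [h1]
  have h2 := Finset.prod_univ_sum (fun _ : s => (Finset.univ : Finset Q)) (fun v q => p v q)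
  rw [Fintype.piFinset_univ] at h2
  rw [← h2]
  simp [hp.sum_eq_one]

lemma IsChargeFamily.totalCharge_mul_self (hp : IsChargeFamily p) (s : Finset ι) (q : Q) :
    totalCharge p s q * totalCharge p s q = totalCharge p s q := by
  conv_rhs => rw [← mul_one (totalCharge p s q), ← hp.sum_totalCharge s, Finset.mul_sum]
  rw [Finset.sum_eq_single q (fun q' _ h => hp.totalCharge_mul_of_ne s h.symm) (by simp)]

variable [Algebra ℂ C] {ω : C →ₗ[ℂ] ℂ}

/-- If no two sites carry a nontrivial charge, then a nontrivial total charge of `s` is also the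
total charge of every larger set of sites. -/
lemma IsChargeFamily.map_totalCharge_mul_totalCharge_eq_zero (hp : IsChargeFamily p)
    (hω : ∀ v w, v ≠ w → ∀ q q', q ≠ 1 → q' ≠ 1 → ∀ A, ω (A * (p v q * p w q')) = 0)
    (hst : s ⊆ t) {q q' : Q} (hq : q ≠ 1) (hqq' : q ≠ q') :
    ω (totalCharge p s q * totalCharge p t q') = 0 := by
  classical
  rw [totalCharge, totalCharge, Finset.sum_mul_sum, map_sum]
  refine Finset.sum_eq_zero fun x hx => ?_
  rw [map_sum]
  refine Finset.sum_eq_zero fun y hy => ?_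
  simp only [Finset.mem_filter, Finset.mem_univ, true_and] at hx hy
  by_cases hxy : ∀ v : s, x v = y ⟨v, hst v.2⟩
  · obtain ⟨v, hv⟩ : ∃ v, x v ≠ 1 := by
      by_contra! h
      exact hq (by rw [← hx]; exact Finset.prod_eq_one fun v _ => h v)
    obtain ⟨w, hws, hw⟩ : ∃ w : t, (w : ι) ∉ s ∧ y w ≠ 1 := by
      by_contra! h
      refine hqq' ?_
      let y' : ι → Q := fun v => if h : v ∈ t then y ⟨v, h⟩ else 1
      have e1 : ∏ v, x v = ∏ v ∈ s, y' v := by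
        rw [← Finset.prod_coe_sort s y']
        exact Finset.prod_congr rfl fun v _ => by simp [y', hxy v, hst v.2]
      have e2 : ∏ v, y v = ∏ v ∈ t, y' v := by
        rw [← Finset.prod_coe_sort t y']
        exact Finset.prod_congr rfl fun v _ => by simp [y']
      rw [← hx, ← hy, e1, e2]
      exact Finset.prod_subset hst fun v hv hvs => by simpa [y', hv] using h ⟨v, hv⟩ hvs
    have h1 : p v (x v) ∣ ∏ w : s, p w (x w) :=
      Finset.dvd_prod_of_mem (fun w : s => p w (x w)) (Finset.mem_univ v)
    have h2 : p w (y w) ∣ ∏ w : t, p w (y w) :=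
      Finset.dvd_prod_of_mem (fun w : t => p w (y w)) (Finset.mem_univ w)
    obtain ⟨A, hA⟩ := mul_dvd_mul h1 h2
    rw [hA, mul_comm]
    exact hω _ _ (fun h => hws (by rw [← h]; exact v.2)) _ _ hv hw _
  · push Not at hxy
    obtain ⟨v, hv⟩ := hxy
    rw [hp.prod_mul_prod v.2 (hst v.2) hv, map_zero]

lemma map_mul_nonneg_of_projections (hω : ∀ A, 0 ≤ ω (star A * A)) {a b : C} (ha : star a = a)
    (ha' : a * a = a) (hb : star b = b) (hb' : b * b = b) : 0 ≤ ω (a * b) := by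
  have h := hω (a * b)
  rwa [star_mul', ha, hb, mul_mul_mul_comm, ha', hb'] at h

/-- Read with the projections as events, this is the bound
`P (f ∧ b ∧ ¬(e ∧ a)) ≤ P (f ∧ ¬e) + P (b ∧ ¬a)`. -/
lemma map_mul_sub_le_of_projections (hω : ∀ A, 0 ≤ ω (star A * A)) {e f a b : C}
    (he : star e = e) (he' : e * e = e) (hf : star f = f) (hf' : f * f = f)
    (ha : star a = a) (ha' : a * a = a) (hb : star b = b) (hb' : b * b = b) :
    (ω (f * b - e * a * (f * b))).re ≤ (ω ((1 - e) * f)).re + (ω ((1 - a) * b)).re := by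
  have hs : ∀ {x : C}, star x = x → star (1 - x) = 1 - x := fun h => by
    rw [star_sub, star_one, h]
  have hm : ∀ {x : C}, x * x = x → (1 - x) * (1 - x) = 1 - x := fun {x} h => by
    linear_combination h
  have hs2 : ∀ {x y : C}, star x = x → star y = y → star (x * y) = x * y :=
    fun h h' => by rw [star_mul', h, h']
  have hm2 : ∀ {x y : C}, x * x = x → y * y = y → x * y * (x * y) = x * y :=
    fun h h' => by rw [mul_mul_mul_comm, h, h']
  -- The left-hand side is `(1 - e) f b + e (1 - a) f b`, and dropping the factors `b` and `e f`
  -- increases the two terms.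
  have h4 := (Complex.nonneg_iff.1 (map_mul_nonneg_of_projections hω (hs2 (hs he) hf)
    (hm2 (hm he') hf') (hs hb) (hm hb'))).1
  have h5 := (Complex.nonneg_iff.1 (map_mul_nonneg_of_projections hω (hs2 (hs ha) hb)
    (hm2 (hm ha') hb') (hs (hs2 he hf)) (hm (hm2 he' hf')))).1
  have h6 : f * b - e * a * (f * b) = (1 - e) * f + (1 - a) * b - (1 - e) * f * (1 - b) -
      (1 - a) * b * (1 - e * f) := by ring
  rw [h6, map_sub, map_sub, map_add, Complex.sub_re, Complex.sub_re, Complex.add_re]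
  linarith

/-- Along an increasing sequence of regions the total charge stabilizes: for `M ≤ L` it is unlikely,
uniformly in `L`, that the total charge is `q` in the region `L` but not in the region `M`. -/
lemma IsChargeFamily.exists_tendsto_zero_bound (hp : IsChargeFamily p)
    (hω0 : ∀ A, 0 ≤ ω (star A * A))
    (hω : ∀ v w, v ≠ w → ∀ q q', q ≠ 1 → q' ≠ 1 → ∀ A, ω (A * (p v q * p w q')) = 0)
    {s : ℕ → Finset ι} (hs : Monotone s) (q : Q) :
    ∃ u : ℕ → ℝ, Tendsto u atTop (𝓝 0) ∧ ∀ M L, M ≤ L →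
      (ω ((1 - totalCharge p (s M) q) * totalCharge p (s L) q)).re ≤ u M := by
  classical
  by_cases hq : q = 1
  · subst hq
    refine ⟨0, tendsto_const_nhds, fun M L hML => ?_⟩
    have h1 : 1 - totalCharge p (s M) 1 = ∑ q ∈ Finset.univ.erase 1, totalCharge p (s M) q := by
      rw [← hp.sum_totalCharge (s M), ← Finset.add_sum_erase _ _ (Finset.mem_univ (1 : Q)),
        add_sub_cancel_left]
    rw [h1, Finset.sum_mul, map_sum, Finset.sum_eq_zero]
    · simp
    · intro q hq
      have hq := Finset.ne_of_mem_erase hq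
      exact hp.map_totalCharge_mul_totalCharge_eq_zero hω (hs hML) hq hq
  · set a : ℕ → ℝ := fun L => (ω (totalCharge p (s L) q)).re with ha
    -- A nontrivial total charge of the region `M` persists in the region `L`.
    have hkey : ∀ M L, M ≤ L → ω (totalCharge p (s M) q * totalCharge p (s L) q) =
        ω (totalCharge p (s M) q) := by
      intro M L hML
      conv_rhs => rw [← mul_one (totalCharge p (s M) q), ← hp.sum_totalCharge (s L),
        Finset.mul_sum, map_sum]
      rw [Finset.sum_eq_single q (fun q' _ h => hp.map_totalCharge_mul_totalCharge_eq_zero hω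
        (hs hML) hq h.symm) (by simp)]
    have hdiff : ∀ M L, M ≤ L →
        (ω ((1 - totalCharge p (s M) q) * totalCharge p (s L) q)).re = a L - a M := by
      intro M L hML
      rw [sub_mul, one_mul, map_sub, hkey M L hML, Complex.sub_re]
    have hproj : ∀ M, star (1 - totalCharge p (s M) q) = 1 - totalCharge p (s M) q ∧
        (1 - totalCharge p (s M) q) * (1 - totalCharge p (s M) q) =
          1 - totalCharge p (s M) q := fun M => by
      refine ⟨by rw [star_sub, star_one, hp.star_totalCharge], ?_⟩
      rw [sub_mul, one_mul, mul_sub, mul_one, hp.totalCharge_mul_self, sub_self, sub_zero]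
    have hmono : Monotone a := fun M L hML => by
      rw [← sub_nonneg, ← hdiff M L hML]
      exact (Complex.nonneg_iff.1 (map_mul_nonneg_of_projections hω0 (hproj M).1 (hproj M).2
        (hp.star_totalCharge _ _) (hp.totalCharge_mul_self _ _))).1
    have hbdd : BddAbove (Set.range a) := by
      refine ⟨(ω 1).re, ?_⟩
      rintro _ ⟨L, rfl⟩
      have h := (Complex.nonneg_iff.1 (map_mul_nonneg_of_projections hω0 (hproj L).1 (hproj L).2
        (hproj L).1 (hproj L).2)).1
      rw [(hproj L).2, map_sub, Complex.sub_re] at h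
      simpa [ha] using h
    refine ⟨fun M => (⨆ L, a L) - a M, ?_, fun M L hML => ?_⟩
    · simpa using (tendsto_atTop_ciSup hmono hbdd).const_sub (⨆ L, a L)
    · rw [hdiff M L hML]
      exact sub_le_sub_right (le_ciSup hbdd L) _

end Total

end Charges

/-! ### The local charge projections -/

section Projections

variable {G : Type*} [CommGroup G]

lemma conj_character [Finite G] (χ : Character G) (g : G) :
    conj (χ g : ℂ) = (χ g⁻¹ : ℂ) := by
  have h : ‖(χ g : ℂ)‖ = 1 := by
    refine Complex.norm_eq_one_of_pow_eq_one (n := Nat.card G) ?_ Nat.card_pos.ne'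
    rw [← Units.val_pow_eq_pow_val, ← map_pow, pow_card_eq_one', map_one, Units.val_one]
  rw [map_inv, Units.val_inv_eq_inv_val, Complex.inv_eq_conj h]

lemma sum_apply_character [Fintype G] (χ : Character G) [Decidable (χ = 1)] :
    ∑ g, (χ g : ℂ) = if χ = 1 then (Fintype.card G : ℂ) else 0 := by
  split_ifs with h
  · simp [h]
  · refine sum_hom_units_eq_zero ((Units.coeHom ℂ).comp χ) fun h' => h ?_
    ext g
    simpa using DFunLike.congr_fun h' g

lemma sum_character_apply [Fintype G] [DecidableEq G] (g : G) :
    ∑ χ : Character G, (χ g : ℂ) = if g = 1 then (Fintype.card G : ℂ) else 0 := by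
  split_ifs with h
  · have := CommGroup.card_monoidHom_of_hasEnoughRootsOfUnity G ℂ
    rw [Nat.card_eq_fintype_card, Nat.card_eq_fintype_card] at this
    simp [h, ← this]
  · obtain ⟨φ, hφ⟩ := CommGroup.exists_apply_ne_one_of_hasEnoughRootsOfUnity G ℂ h
    refine sum_hom_units_eq_zero ((Units.coeHom ℂ).comp (MonoidHom.eval g : Character G →* ℂˣ))
      fun h' => hφ ?_
    have := DFunLike.congr_fun h' φ
    exact Units.ext (by simpa using this)

variable [Fintype G] [DecidableEq G]

lemma observable_ext {A B : Observable G}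
    (h : ∀ (ψ : HilbertSp G) (c : Edge → G), (A : HilbertSp G →L[ℂ] HilbertSp G) ψ c =
      (B : HilbertSp G →L[ℂ] HilbertSp G) ψ c) : A = B := by
  apply Subtype.ext
  ext ψ c
  exact h ψ c

lemma observable_mul_apply (A B : Observable G) (ψ : HilbertSp G) :
    ((A * B : Observable G) : HilbertSp G →L[ℂ] HilbertSp G) ψ =
      (A : HilbertSp G →L[ℂ] HilbertSp G) ((B : HilbertSp G →L[ℂ] HilbertSp G) ψ) := rfl

omit [Fintype G] [DecidableEq G] in
/-- The gauge transformation at `v`, written as that of the function supported at `v`. -/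
lemma patch_gauge (v : Vertex) (g : G) (c : Edge → G) (e : Edge) :
    patch c (gauge v g ((starEdges v).restrict c)) e =
      Pi.mulSingle (M := fun _ => G) v g (edgeSource e) * c e *
        (Pi.mulSingle (M := fun _ => G) v g (edgeTarget e))⁻¹ := by
  have hne : edgeTarget e ≠ edgeSource e := by
    obtain ⟨⟨x, y⟩, b⟩ := e
    cases b <;> simp [edgeTarget, edgeSource]
  have hmem := mem_starEdges v e
  by_cases hs : edgeSource e = v
  · subst hs
    simp [patch, hmem, gauge, hne]
  · by_cases ht : edgeTarget e = v
    · subst ht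
      simp [patch, hmem, gauge, hne.symm]
    · simp [patch, hmem, hs, ht]

omit [Fintype G] [DecidableEq G] in
lemma monodromy_restrict (f : Vertex) (c : Edge → G) :
    monodromy f ((plaquetteEdges f).restrict c) =
      c (f, true) * c (f + (0, 1), false) * (c (f + (1, 0), true))⁻¹ * (c (f, false))⁻¹ := rfl

lemma starOp_mul (v : Vertex) (g h : G) : starOp v g * starOp v h = starOp v (g * h) := by
  refine observable_ext fun ψ c => ?_
  rw [observable_mul_apply, starOp_apply, starOp_apply, starOp_apply]
  refine congrArg (fun b : Edge → G => ψ b) (funext fun e => ?_)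
  simp only [patch_gauge, mul_inv, Pi.mulSingle_mul, Pi.mul_apply]
  ac_rfl

lemma starOp_one (v : Vertex) : starOp v (1 : G) = 1 := by
  refine observable_ext fun ψ c => ?_
  rw [starOp_apply]
  change _ = ψ c
  refine congrArg (fun b : Edge → G => ψ b) (funext fun e => ?_)
  simp [patch_gauge]

lemma star_starOp (v : Vertex) (g : G) : star (starOp v g) = starOp v g⁻¹ := by
  rw [starOp, starOp, ← map_star]
  congr 1
  ext a b
  have h : b = gauge v g a ↔ a = gauge v g⁻¹ b := by
    refine ⟨fun h => by rw [h, gauge_gauge], fun h => ?_⟩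
    have := gauge_gauge v g⁻¹ b
    rw [inv_inv] at this
    rw [h, this]
  simp [Matrix.star_apply, h]

lemma starOp_mul_starProj (v : Vertex) (g : G) (χ : Character G) :
    starOp v g * starProj v χ = (χ g : ℂ) • starProj v χ := by
  have key : starOp v g * ∑ h : G, conj (χ h : ℂ) • starOp v h =
      (χ g : ℂ) • ∑ h : G, conj (χ h : ℂ) • starOp v h := by
    rw [Finset.mul_sum, Finset.smul_sum]
    refine Fintype.sum_equiv (Equiv.mulLeft g) _ _ fun h => ?_
    rw [mul_smul_comm, starOp_mul, smul_smul, conj_character, conj_character, Equiv.coe_mulLeft,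
      ← Units.val_mul, ← map_mul, mul_inv, mul_inv_cancel_left]
  rw [starProj, mul_smul_comm, key, smul_comm]

lemma isChargeFamily_starProj :
    IsChargeFamily (starProj : Vertex → Character G → Observable G) := by
  classical
  have hcard : (Fintype.card G : ℂ) ≠ 0 := Nat.cast_ne_zero.2 Fintype.card_ne_zero
  have hmul : ∀ (v : Vertex) (χ ξ : Character G), starProj v χ * starProj v ξ =
      (if χ = ξ then (1 : ℂ) else 0) • starProj v ξ := by
    intro v χ ξ
    rw [starProj, smul_mul_assoc, Finset.sum_mul]
    simp only [smul_mul_assoc, starOp_mul_starProj, smul_smul, ← Finset.sum_smul]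
    congr 1
    have h : ∀ g, conj (χ g : ℂ) * (ξ g : ℂ) = ((χ⁻¹ * ξ) g : ℂˣ) := fun g => by
      rw [conj_character, map_inv]; simp
    simp only [h]
    rw [sum_apply_character]
    by_cases hχ : χ = ξ
    · rw [if_pos (inv_mul_eq_one.2 hχ), if_pos hχ, inv_mul_cancel₀ hcard]
    · have h1 : χ⁻¹ * ξ ≠ 1 := fun h => hχ (inv_mul_eq_one.1 h)
      rw [if_neg h1, if_neg hχ, mul_zero]
  refine ⟨fun v χ => ?_, fun v χ => by simpa using hmul v χ χ,
    fun v χ ξ h => by simpa [h] using hmul v χ ξ, fun v => ?_⟩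
  · rw [starProj, star_smul, star_sum]
    congr 1
    · simp
    · refine Fintype.sum_equiv (Equiv.inv G) _ _ fun g => ?_
      rw [star_smul, star_starOp, Equiv.inv_apply, conj_character, conj_character, inv_inv,
        ← conj_character, RCLike.star_def, conj_character, conj_character, inv_inv]
  · simp only [starProj]
    rw [← Finset.smul_sum, Finset.sum_comm]
    simp only [← Finset.sum_smul, conj_character, sum_character_apply, inv_eq_one]
    simp [starOp_one, hcard]

lemma isChargeFamily_plaquetteProj :
    IsChargeFamily (plaquetteProj : Vertex → G → Observable G) := by
  refine ⟨fun f c => ?_, fun f c => ?_, fun f c d h => ?_, fun f => ?_⟩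
  · rw [plaquetteProj, plaquetteOp, ← map_star]
    congr 1
    rw [Matrix.star_eq_conjTranspose, Matrix.diagonal_conjTranspose]
    congr 1
    funext b
    simp [apply_ite]
  · rw [plaquetteProj, plaquetteOp, ← map_mul, Matrix.diagonal_mul_diagonal]
    simp only [mul_ite, mul_one, mul_zero]
    congr! 3
    split_ifs <;> rfl
  · rw [plaquetteProj, plaquetteProj, plaquetteOp, plaquetteOp, ← map_mul,
      Matrix.diagonal_mul_diagonal]
    refine (congrArg _ ?_).trans (map_zero (localObs G (plaquetteEdges f)))
    rw [Matrix.diagonal_eq_zero]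
    funext b
    by_cases hb : monodromy f b = c
    · simp [hb, h]
    · simp [hb]
  · simp only [plaquetteProj, plaquetteOp]
    rw [← map_sum]
    refine (congrArg _ ?_).trans (map_one (localObs G (plaquetteEdges f)))
    ext a b
    simp only [Matrix.sum_apply, Matrix.diagonal_apply, Matrix.one_apply]
    by_cases h : a = b <;> simp [h]

lemma commute_starOp_plaquetteProj (v f : Vertex) (g c : G) :
    Commute (starOp v g) (plaquetteProj f c) := by
  refine observable_ext fun ψ b => ?_
  simp only [plaquetteProj]
  rw [observable_mul_apply, observable_mul_apply, starOp_apply, plaquetteOp_apply,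
    plaquetteOp_apply, starOp_apply]
  congr 2
  -- The contributions of the corners cancel around the face.
  simp only [monodromy_restrict, patch_gauge, edgeSource, edgeTarget, mul_inv, inv_inv,
    if_true, Bool.false_eq_true, if_false, add_right_comm f (1, 0) (0, 1)]
  simp only [mul_assoc, mul_comm, mul_left_comm, mul_inv_cancel_left, mul_inv_cancel]
  simp only [one_mul]

lemma commute_starProj_plaquetteProj (v f : Vertex) (χ : Character G) (c : G) :
    Commute (starProj v χ) (plaquetteProj f c) :=
  (Commute.sum_left _ _ _ fun g _ =>
    (commute_starOp_plaquetteProj v f g c).smul_left _).smul_left _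

lemma starTerm_eq (v : Vertex) : starTerm G v = starProj v 1 := by
  simp [starTerm, starProj]

lemma hamiltonian_eq (Λ : Finset Edge) : hamiltonian G Λ =
    ∑ v ∈ starsIn Λ, (1 - starProj v (1 : Character G)) +
      ∑ f ∈ plaquettesIn Λ, (1 - plaquetteProj f (1 : G)) := by
  simp only [hamiltonian, starTerm_eq]; rfl

end Projections

/-! ### Ground states and eigenoperators of the derivation -/

section GroundStates

variable {G : Type*} [CommGroup G] [Fintype G] [DecidableEq G]

variable (G) in
/-- The local observables, as a subalgebra of the quasi-local algebra. -/
noncomputable def localObservables : StarSubalgebra ℂ (Observable G) :=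
  (localAlgebra G).comap (quasiLocalAlgebra G).subtype

lemma mem_localObservables {A : Observable G} : A ∈ localObservables G ↔ IsLocal G A := by
  constructor
  · rintro ⟨Λ, M, h⟩
    exact ⟨Λ, M, Subtype.ext h⟩
  · rintro ⟨Λ, M, rfl⟩
    exact ⟨Λ, M, rfl⟩

lemma isLocal_starProj (v : Vertex) (χ : Character G) : IsLocal G (starProj v χ) := by
  rw [← mem_localObservables, starProj]
  exact SMulMemClass.smul_mem _ (sum_mem fun g _ => SMulMemClass.smul_mem _
    (mem_localObservables.2 ⟨_, _, rfl⟩))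

lemma isLocal_plaquetteProj (f : Vertex) (c : G) : IsLocal G (plaquetteProj f c) := ⟨_, _, rfl⟩

lemma derivation_eq_of_eventually {A B : Observable G}
    (h : ∀ᶠ L : ℕ in atTop, hamiltonian G (box L) * A - A * hamiltonian G (box L) = B) :
    derivation A = B :=
  (tendsto_const_nhds.congr' (h.mono fun _ h => h.symm)).limUnder_eq

variable (G) in
/-- The local observables which commute with all terms that the Hamiltonians of larger boxes add to
that of `box R`. On these the derivation is the commutator with the latter. -/
noncomputable def interior (R : ℕ) : Subalgebra ℂ (Observable G) :=
  (localObservables G).toSubalgebra ⊓ Subalgebra.centralizer ℂ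
    {X | ∃ L, R ≤ L ∧ X = hamiltonian G (box L) - hamiltonian G (box R)}

lemma mem_interior {R : ℕ} {A : Observable G} : A ∈ interior G R ↔ IsLocal G A ∧
    ∀ L, R ≤ L → Commute (hamiltonian G (box L) - hamiltonian G (box R)) A := by
  rw [interior, Algebra.mem_inf, Subalgebra.mem_centralizer_iff, StarSubalgebra.mem_toSubalgebra,
    mem_localObservables]
  refine and_congr Iff.rfl ⟨fun h L hL => h _ ⟨L, hL, rfl⟩, ?_⟩
  rintro h _ ⟨L, hL, rfl⟩
  exact h L hL

lemma derivation_eq_of_mem_interior {R : ℕ} {A : Observable G} (hA : A ∈ interior G R) :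
    derivation A = hamiltonian G (box R) * A - A * hamiltonian G (box R) := by
  refine derivation_eq_of_eventually ?_
  filter_upwards [eventually_ge_atTop R] with L hL
  have h := ((mem_interior.1 hA).2 L hL).eq
  rw [sub_mul, mul_sub, sub_eq_sub_iff_add_eq_add] at h
  rw [sub_eq_sub_iff_add_eq_add, h, add_comm]

lemma exists_mem_interior {A : Observable G} (hA : IsLocal G A) : ∃ R, A ∈ interior G R := by
  obtain ⟨Λ, M, rfl⟩ := hA
  obtain ⟨R, hR⟩ := exists_box Λ
  refine ⟨R + 1, mem_interior.2 ⟨⟨Λ, M, rfl⟩, fun L hL => ?_⟩⟩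
  have h := commutator_eq hR hL M
  rw [sub_eq_sub_iff_add_eq_add] at h
  rw [Commute, SemiconjBy, sub_mul, mul_sub, sub_eq_sub_iff_add_eq_add, h, add_comm]

lemma commute_starProj_hamiltonian (v : Vertex) (χ : Character G) (Λ : Finset Edge) :
    Commute (starProj v χ) (hamiltonian G Λ) := by
  rw [hamiltonian_eq]
  exact (Commute.sum_right _ _ _ fun w _ => (Commute.one_right _).sub_right
    (commute_starProj v w χ 1)).add_right (Commute.sum_right _ _ _ fun f _ =>
      (Commute.one_right _).sub_right (commute_starProj_plaquetteProj v f χ 1))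

lemma commute_plaquetteProj_hamiltonian (f : Vertex) (c : G) (Λ : Finset Edge) :
    Commute (plaquetteProj f c) (hamiltonian G Λ) := by
  rw [hamiltonian_eq]
  exact (Commute.sum_right _ _ _ fun v _ => (Commute.one_right _).sub_right
    (commute_starProj_plaquetteProj v f 1 c).symm).add_right (Commute.sum_right _ _ _ fun f' _ =>
      (Commute.one_right _).sub_right (commute_plaquetteProj f f' c 1))

/-- Every local observable is a finite sum of eigenoperators of the derivation. -/
lemma exists_eigen_decomposition_of_isLocal {A : Observable G} (hA : IsLocal G A) :
    ∃ (R : ℕ) (t : Finset ℤ) (f : ℤ → Observable G),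
      (∀ k, f k ∈ eigenOperators (interior G R) (hamiltonian G (box R)) k) ∧
        A = ∑ k ∈ t, f k := by
  obtain ⟨R, hR⟩ := exists_mem_interior hA
  refine ⟨R, exists_eigen_decomposition ?_⟩
  let p : Vertex ⊕ Vertex → Observable G :=
    Sum.elim (fun v => 1 - starProj v (1 : Character G)) (fun f => 1 - plaquetteProj f (1 : G))
  have hH : hamiltonian G (box R) =
      ∑ i ∈ (starsIn (box R)).disjSum (plaquettesIn (box R)), p i := by
    rw [Finset.sum_disjSum, hamiltonian_eq]; rfl
  rw [hH]
  refine mem_iSup_eigenOperators_sum _ p ?_ ?_ ?_ hR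
  · rintro (v | f) -
    · change (1 - starProj v (1 : Character G)) * (1 - starProj v 1) = 1 - starProj v 1
      rw [sub_mul, one_mul, mul_sub, mul_one, isChargeFamily_starProj.mul_self, sub_self, sub_zero]
    · change (1 - plaquetteProj f (1 : G)) * (1 - plaquetteProj f 1) = 1 - plaquetteProj f 1
      rw [sub_mul, one_mul, mul_sub, mul_one, isChargeFamily_plaquetteProj.mul_self, sub_self,
        sub_zero]
  · rintro (v | f) -
    · refine Subalgebra.sub_mem _ (Subalgebra.one_mem _)
        (mem_interior.2 ⟨isLocal_starProj v 1, fun L _ => ?_⟩)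
      exact ((commute_starProj_hamiltonian v 1 _).sub_right
        (commute_starProj_hamiltonian v 1 _)).symm
    · refine Subalgebra.sub_mem _ (Subalgebra.one_mem _)
        (mem_interior.2 ⟨isLocal_plaquetteProj f 1, fun L _ => ?_⟩)
      exact ((commute_plaquetteProj_hamiltonian f 1 _).sub_right
        (commute_plaquetteProj_hamiltonian f 1 _)).symm
  · have h1 : ∀ {a b : Observable G}, Commute a b → Commute (1 - a) (1 - b) := fun h =>
      ((Commute.one_right _).sub_right ((Commute.one_left _).sub_left h))
    rintro (v | f) - (w | f') -
    · exact h1 (commute_starProj v w 1 1)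
    · exact h1 (commute_starProj_plaquetteProj v f' 1 1)
    · exact h1 (commute_starProj_plaquetteProj w f 1 1).symm
    · exact h1 (commute_plaquetteProj f f' 1 1)

lemma star_hamiltonian (Λ : Finset Edge) : star (hamiltonian G Λ) = hamiltonian G Λ := by
  simp [hamiltonian_eq, isChargeFamily_starProj.star_eq, isChargeFamily_plaquetteProj.star_eq]

lemma star_mem_interior {R : ℕ} {A : Observable G} (hA : A ∈ interior G R) :
    star A ∈ interior G R := by
  rw [mem_interior] at hA ⊢
  refine ⟨mem_localObservables.1 (star_mem (mem_localObservables.2 hA.1)), fun L hL => ?_⟩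
  have h := (hA.2 L hL).star_star
  rwa [star_sub, star_hamiltonian, star_hamiltonian] at h

lemma star_mem_eigenOperators {R : ℕ} {A : Observable G} {k : ℤ}
    (hA : A ∈ eigenOperators (interior G R) (hamiltonian G (box R)) k) :
    star A ∈ eigenOperators (interior G R) (hamiltonian G (box R)) (-k) := by
  refine ⟨star_mem_interior hA.1, ?_⟩
  have h := congrArg star hA.2
  rw [star_sub, star_mul, star_mul, star_hamiltonian, star_smul, RCLike.star_def,
    map_intCast] at h
  rw [Int.cast_neg, neg_smul, ← h, neg_sub]

/-- A state is a ground state if and only if it annihilates `B⋆ B` for all local observables `B`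
which lower the energy. -/
lemma mem_groundStates_iff {ω : Observable G →ₗ[ℂ] ℂ} : ω ∈ groundStates G ↔ ω ∈ states G ∧
    ∀ (B : Observable G) (k : ℝ), IsLocal G B → k < 0 → derivation B = (k : ℂ) • B →
      ω (star B * B) = 0 := by
  constructor
  · rintro ⟨hω, hK⟩
    refine ⟨hω, fun B k hB hk hδ => ?_⟩
    have h1 := hω.1 B
    have h2 := hK B hB
    rw [hδ, mul_smul_comm, map_smul, smul_eq_mul] at h2
    obtain ⟨x, hx⟩ : ∃ x : ℝ, ω (star B * B) = x :=
      ⟨_, (Complex.ext rfl (Complex.nonneg_iff.1 h1).2.symm : ω (star B * B) =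
        ((ω (star B * B)).re : ℂ))⟩
    rw [hx] at h1 h2 ⊢
    rw [← Complex.ofReal_mul, Complex.zero_le_real] at h2
    rw [Complex.zero_le_real] at h1
    rw [Complex.ofReal_eq_zero]
    nlinarith
  · rintro ⟨hω, h⟩
    refine ⟨hω, fun A hA => ?_⟩
    obtain ⟨R, t, f, hf, rfl⟩ := exists_eigen_decomposition_of_isLocal hA
    have hnull : ∀ (B : Observable G) (k : ℤ), k < 0 →
        B ∈ eigenOperators (interior G R) (hamiltonian G (box R)) k → ω (star B * B) = 0 := by
      intro B k hk hB
      refine h B k (mem_interior.1 hB.1).1 (by exact_mod_cast hk) ?_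
      rw [derivation_eq_of_mem_interior hB.1, hB.2]
      simp
    have hfS : ∀ k, f k ∈ interior G R := fun k => (hf k).1
    rw [derivation_eq_of_mem_interior (sum_mem fun k _ => hfS k), Finset.mul_sum, Finset.sum_mul,
      ← Finset.sum_sub_distrib, Finset.sum_congr rfl fun k _ => (hf k).2, star_sum,
      Finset.sum_mul_sum, map_sum]
    refine Finset.sum_nonneg fun j _ => ?_
    rw [map_sum]
    refine Finset.sum_nonneg fun k _ => ?_
    rw [mul_smul_comm, map_smul, smul_eq_mul]
    by_cases hjk : j = k
    · subst hjk
      rcases lt_or_ge j 0 with hj | hj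
      · rw [hnull _ j hj (hf j), mul_zero]
      · exact mul_nonneg (by exact_mod_cast hj) (hω.1 _)
    -- The cross terms vanish, since a functional which annihilates all energy lowering
    -- operators also annihilates their adjoints.
    · have hB := mul_mem_eigenOperators (star_mem_eigenOperators (hf j)) (hf k)
      suffices h0 : ω (star (f j) * f k) = 0 by rw [h0, mul_zero]
      rcases lt_or_gt_of_ne (show -j + k ≠ 0 by omega) with hm | hm
      · simpa using map_mul_eq_zero_of_null hω.1 (hnull _ _ hm hB) 1
      · have h1 := map_star_mul_eq_zero_of_null hω.1
          (hnull _ _ (neg_lt_zero.2 hm) (star_mem_eigenOperators hB)) 1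
        simpa using h1

end GroundStates

/-! ### Moving charges -/

section Transport

variable {G : Type*} [CommGroup G] [Fintype G] [DecidableEq G]

section Abstract

variable {Q : Type*} [CommGroup Q]

/-- The changes `τ` of the charges `p` that are implemented by local isometries commuting with
`E`. -/
def transports (p : Vertex → Q → Observable G) (E : Set (Observable G)) :
    Submonoid (Vertex → Q) where
  carrier := {τ | ∃ U : Observable G, IsLocal G U ∧ star U * U = 1 ∧
    (∀ u q, p u q * U = U * p u (q * τ u)) ∧ ∀ X ∈ E, Commute X U}
  one_mem' := ⟨1, mem_localObservables.1 (one_mem _), by simp, by simp,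
    fun X _ => Commute.one_right X⟩
  mul_mem' := by
    rintro τ σ ⟨U, hU, hU1, hUp, hUE⟩ ⟨V, hV, hV1, hVp, hVE⟩
    refine ⟨U * V, mem_localObservables.1 (mul_mem (mem_localObservables.2 hU)
      (mem_localObservables.2 hV)), ?_, fun u q => ?_, fun X hX => (hUE X hX).mul_right (hVE X hX)⟩
    · rw [star_mul, mul_assoc, ← mul_assoc (star U), hU1, one_mul, hV1]
    · rw [← mul_assoc, hUp, mul_assoc, hVp, mul_assoc, Pi.mul_apply, mul_assoc]

variable {p : Vertex → Q → Observable G} {E : Set (Observable G)}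

/-- Any charge can be moved between any two sites once it can be moved between neighbours. -/
lemma mulSingle_mul_mulSingle_inv_mem (S : Submonoid (Vertex → Q))
    (h1 : ∀ (v : Vertex) (q : Q), Pi.mulSingle v q * Pi.mulSingle (v + (1, 0)) q⁻¹ ∈ S)
    (h2 : ∀ (v : Vertex) (q : Q), Pi.mulSingle v q * Pi.mulSingle (v + (0, 1)) q⁻¹ ∈ S)
    (v w : Vertex) (q : Q) : Pi.mulSingle v q * Pi.mulSingle w q⁻¹ ∈ S := by
  let r : Vertex → Vertex → Prop := fun v w => ∀ q : Q, Pi.mulSingle v q * Pi.mulSingle w q⁻¹ ∈ S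
  have hrefl : ∀ v, r v v := fun v q => by
    rw [← Pi.mulSingle_mul]; simp
  have hsymm : ∀ {v w}, r v w → r w v := fun h q => by
    have := h q⁻¹
    rwa [inv_inv, mul_comm] at this
  have htrans : ∀ {u v w}, r u v → r v w → r u w := fun {u v w} h h' q => by
    convert S.mul_mem (h q) (h' q) using 1
    funext x
    simp only [Pi.mul_apply, Pi.mulSingle_apply]
    split_ifs <;> simp
  have hx : ∀ x y : ℤ, r (x, y) (0, y) := fun x y => by
    induction x using Int.induction_on with
    | zero => exact hrefl _
    | succ n ih =>
      refine htrans (hsymm fun q => ?_) ih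
      simpa using h1 ((n : ℤ), y) q
    | pred n ih =>
      refine htrans (fun q => ?_) ih
      simpa using h1 (-(n : ℤ) - 1, y) q
  have hy : ∀ y : ℤ, r (0, y) (0, 0) := fun y => by
    induction y using Int.induction_on with
    | zero => exact hrefl _
    | succ n ih =>
      refine htrans (hsymm fun q => ?_) ih
      simpa using h2 (0, (n : ℤ)) q
    | pred n ih =>
      refine htrans (fun q => ?_) ih
      simpa using h2 (0, -(n : ℤ) - 1) q
  have h0 : ∀ v, r v (0, 0) := fun v => htrans (hx v.1 v.2) (hy v.2)
  exact htrans (h0 v) (hsymm (h0 w)) q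

/-- A ground state does not charge two sites: fusing the two charges would lower the energy. -/
lemma map_mul_eq_zero_of_transports [Fintype Q] {ω : Observable G →ₗ[ℂ] ℂ}
    (hω : ω ∈ groundStates G)
    (hp : IsChargeFamily p) (hloc : ∀ v q, IsLocal G (p v q))
    (hcomm : ∀ v w q q', Commute (p v q) (p w q')) (hE : ∀ X ∈ E, ∀ v q, Commute X (p v q))
    (hT : ∀ v w q, Pi.mulSingle v q * Pi.mulSingle w q⁻¹ ∈ transports p E)
    (s : ℕ → Finset Vertex) (hs : ∀ v, ∀ᶠ L in atTop, v ∈ s L) (K : ℕ → Observable G)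
    (hK : ∀ L, K L ∈ E)
    (hH : ∀ L, hamiltonian G (box L) = ∑ u ∈ s L, (1 - p u 1) + K L)
    {v w : Vertex} (hvw : v ≠ w) {q q' : Q} (hq : q ≠ 1) (hq' : q' ≠ 1) (A : Observable G) :
    ω (A * (p v q * p w q')) = 0 := by
  classical
  obtain ⟨U, hU, hU1, hUp, hUE⟩ := hT w v q'
  set τ : Vertex → Q := Pi.mulSingle w q' * Pi.mulSingle v q'⁻¹ with hτ
  set P := p v q * p w q' with hP
  have hPcomm : ∀ u r, Commute (p u r) P := fun u r =>
    (hcomm u v r q).mul_right (hcomm u w r q')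
  have hPstar : star P = P := by
    rw [hP, star_mul, hp.star_eq, hp.star_eq, (hcomm w v q' q).eq]
  have hPP : P * P = P := by
    rw [hP, mul_assoc, ← mul_assoc (p w q'), (hcomm w v q' q).eq, mul_assoc (p v q), hp.mul_self,
      ← mul_assoc, hp.mul_self]
  have hvP : ∀ r, p v r * P = if r = q then P else 0 := fun r => by
    split_ifs with h
    · rw [h, hP, ← mul_assoc, hp.mul_self]
    · rw [hP, ← mul_assoc, hp.mul_of_ne _ _ _ h, zero_mul]
  have hwP : ∀ r, p w r * P = if r = q' then P else 0 := fun r => by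
    rw [hP, (hcomm v w q q').eq]
    split_ifs with h
    · rw [h, ← mul_assoc, hp.mul_self]
    · rw [← mul_assoc, hp.mul_of_ne _ _ _ h, zero_mul]
  have hτw : τ w = q' := by simp [hτ, hvw.symm]
  have hτv : τ v = q'⁻¹ := by simp [hτ, hvw]
  have hτu : ∀ u, u ≠ v → u ≠ w → τ u = 1 := fun u h h' => by simp [hτ, h, h']
  -- The change of the energy at `u` when `U` is applied to the range of `P`.
  let c : Vertex → ℤ := fun u => if u = w then -1 else if u = v ∧ q'⁻¹ = q then -1 else 0
  have hc : ∀ u, (1 - p u 1) * (U * P) - U * P * (1 - p u 1) = (c u : ℂ) • (U * P) := by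
    intro u
    have h1 : (1 - p u 1) * (U * P) - U * P * (1 - p u 1) =
        U * (p u 1 * P) - U * (p u (τ u) * P) := by
      have h2 : p u 1 * (U * P) = U * (p u (τ u) * P) := by
        rw [← mul_assoc, hUp, one_mul, mul_assoc]
      rw [sub_mul, mul_sub, one_mul, mul_one, h2, mul_assoc U P, (hPcomm u 1).eq]
      abel
    rw [h1]
    by_cases huw : u = w
    · subst huw
      rw [hτw, hwP, hwP, if_neg hq'.symm, if_pos rfl]
      simp [c]
    · by_cases huv : u = v
      · subst huv
        rw [hτv, hvP, hvP, if_neg hq.symm]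
        by_cases hqq : q'⁻¹ = q <;> simp [c, huw, hqq]
      · rw [hτu u huv huw]
        simp [c, huw, huv]
  have hδ : derivation (U * P) = ((∑ u ∈ {v, w}, c u : ℤ) : ℂ) • (U * P) := by
    refine derivation_eq_of_eventually ?_
    filter_upwards [hs v, hs w] with L hLv hLw
    have hKL : Commute (K L) (U * P) := (hUE _ (hK L)).mul_right
      ((hE _ (hK L) v q).mul_right (hE _ (hK L) w q'))
    have hsub : ∑ u ∈ {v, w}, c u = ∑ u ∈ s L, c u := by
      refine Finset.sum_subset (fun u hu => ?_) fun u _ hu => ?_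
      · rcases Finset.mem_insert.1 hu with rfl | hu
        · exact hLv
        · rwa [Finset.mem_singleton.1 hu]
      · simp only [Finset.mem_insert, Finset.mem_singleton, not_or] at hu
        simp [c, hu.1, hu.2]
    rw [hsub, hH, add_mul, mul_add, hKL.eq, add_sub_add_right_eq_sub, Finset.sum_mul,
      Finset.mul_sum, ← Finset.sum_sub_distrib, Finset.sum_congr rfl fun u _ => hc u,
      ← Finset.sum_smul, Int.cast_sum]
  have hneg : ∑ u ∈ {v, w}, c u < 0 := by
    rw [Finset.sum_pair hvw]
    have h1 : c w = -1 := by simp [c]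
    have h2 : c v ≤ 0 := by
      simp only [c]
      split_ifs <;> simp
    omega
  have hPloc : IsLocal G (U * P) := mem_localObservables.1 (mul_mem (mem_localObservables.2 hU)
    (mul_mem (mem_localObservables.2 (hloc v q)) (mem_localObservables.2 (hloc w q'))))
  have h0 := (mem_groundStates_iff.1 hω).2 (U * P) ((∑ u ∈ {v, w}, c u : ℤ) : ℝ) hPloc
    (by exact_mod_cast hneg) (by rw [hδ]; simp)
  refine map_mul_eq_zero_of_null hω.1.1 ?_ A
  rwa [star_mul, mul_assoc, ← mul_assoc (star U), hU1, one_mul] at h0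

end Abstract

/-! ### Single edge operators -/

/-- Multiplication of the basis vector of `b` by `ξ (b e)`: it transports electric charge between
the two ends of the edge `e`. -/
noncomputable def edgePhase (e : Edge) (ξ : Character G) : Observable G :=
  localObs G {e} (Matrix.diagonal fun b => (ξ (b ⟨e, Finset.mem_singleton_self e⟩) : ℂ))

/-- The operator `ψ ↦ (b ↦ ψ (b'))`, with `b'` obtained from `b` by multiplying `b e` by `g`: it
transports magnetic charge between the two faces at the edge `e`. -/
noncomputable def edgeShift (e : Edge) (g : G) : Observable G :=
  localObs G {e} (Matrix.of fun a b => if b = fun i => g * a i then 1 else 0)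

lemma edgePhase_apply (e : Edge) (ξ : Character G) (ψ : HilbertSp G) (c : Edge → G) :
    (edgePhase e ξ : HilbertSp G →L[ℂ] HilbertSp G) ψ c = (ξ (c e) : ℂ) * ψ c := by
  change localRep {e} _ ψ c = _
  simp [localRep_apply, Matrix.diagonal_apply, patch_restrict]

lemma edgeShift_apply (e : Edge) (g : G) (ψ : HilbertSp G) (c : Edge → G) :
    (edgeShift e g : HilbertSp G →L[ℂ] HilbertSp G) ψ c =
      ψ (fun e' => if e' = e then g * c e' else c e') := by
  change localRep {e} _ ψ c = _
  rw [localRep_apply, Finset.sum_eq_single (fun i => g * Finset.restrict {e} c i)]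
  · simp only [Matrix.of_apply, if_true, one_mul]
    refine congrArg (fun b : Edge → G => ψ b) (funext fun e' => ?_)
    by_cases h : e' = e <;> simp [patch, h]
  · intro d _ hd
    rw [Matrix.of_apply, if_neg hd, zero_mul]
  · simp

lemma star_edgePhase_mul (e : Edge) (ξ : Character G) :
    star (edgePhase e ξ) * edgePhase e ξ = 1 := by
  rw [edgePhase, ← map_star, ← map_mul, Matrix.star_eq_conjTranspose,
    Matrix.diagonal_conjTranspose, Matrix.diagonal_mul_diagonal]
  refine (congrArg _ ?_).trans (map_one (localObs G {e}))
  rw [← Matrix.diagonal_one]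
  congr 1
  funext b
  rw [Pi.star_apply, RCLike.star_def, conj_character, ← Units.val_mul, ← map_mul]
  simp

lemma star_edgeShift_mul (e : Edge) (g : G) : star (edgeShift e g) * edgeShift e g = 1 := by
  rw [edgeShift, ← map_star, ← map_mul]
  refine (congrArg _ ?_).trans (map_one (localObs G {e}))
  ext a b
  rw [Matrix.mul_apply, Finset.sum_eq_single (fun i => g⁻¹ * a i)]
  · simp [Matrix.star_apply, Matrix.one_apply, eq_comm]
  · intro c _ hc
    have h : ¬ a = fun i => g * c i := fun h => hc (by funext i; simp [h])
    simp [Matrix.star_apply, h]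
  · simp

lemma starProj_mul_edgePhase (v : Vertex) (χ : Character G) (e : Edge) (ξ : Character G) :
    starProj v χ * edgePhase e ξ = edgePhase e ξ * starProj v
      (χ * (Pi.mulSingle (M := fun _ => Character G) (edgeSource e) ξ *
        Pi.mulSingle (M := fun _ => Character G) (edgeTarget e) ξ⁻¹ : Vertex → Character G) v) := by
  set τ := (Pi.mulSingle (M := fun _ => Character G) (edgeSource e) ξ *
    Pi.mulSingle (M := fun _ => Character G) (edgeTarget e) ξ⁻¹ : Vertex → Character G) v with hτ
  have key : ∀ g : G, starOp v g * edgePhase e ξ =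
      (τ g⁻¹ : ℂ) • (edgePhase e ξ * starOp v g) := by
    intro g
    refine observable_ext fun ψ c => ?_
    change _ = (τ g⁻¹ : ℂ) * ((edgePhase e ξ * starOp v g : Observable G) :
      HilbertSp G →L[ℂ] HilbertSp G) ψ c
    rw [observable_mul_apply, observable_mul_apply, starOp_apply, edgePhase_apply, edgePhase_apply,
      starOp_apply, ← mul_assoc, patch_gauge, ← Units.val_mul]
    congr 2
    rw [hτ, map_mul, map_mul, mul_right_comm]
    congr 1
    rw [Pi.mul_apply, MonoidHom.mul_apply]
    congr 1
    · by_cases h : edgeSource e = v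
      · subst h; simp
      · rw [Pi.mulSingle_eq_of_ne h, Pi.mulSingle_eq_of_ne (Ne.symm h)]; simp
    · by_cases h : edgeTarget e = v
      · subst h; simp
      · rw [Pi.mulSingle_eq_of_ne h, Pi.mulSingle_eq_of_ne (Ne.symm h)]; simp
  rw [starProj, starProj, smul_mul_assoc, mul_smul_comm, Finset.sum_mul, Finset.mul_sum]
  congr 1
  refine Finset.sum_congr rfl fun g _ => ?_
  rw [smul_mul_assoc, key, smul_smul, mul_smul_comm, conj_character, conj_character,
    MonoidHom.mul_apply, Units.val_mul]

lemma commute_plaquetteProj_edgePhase (f : Vertex) (h : G) (e : Edge) (ξ : Character G) :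
    Commute (plaquetteProj f h) (edgePhase e ξ) := by
  refine observable_ext fun ψ c => ?_
  simp only [plaquetteProj, observable_mul_apply, plaquetteOp_apply, edgePhase_apply, mul_ite,
    mul_zero]

lemma commute_starProj_edgeShift (v : Vertex) (χ : Character G) (e : Edge) (g : G) :
    Commute (starProj v χ) (edgeShift e g) := by
  refine (Commute.sum_left _ _ _ fun h _ => Commute.smul_left ?_ _).smul_left _
  refine observable_ext fun ψ c => ?_
  rw [observable_mul_apply, observable_mul_apply, starOp_apply, edgeShift_apply, edgeShift_apply,
    starOp_apply]
  refine congrArg (fun b : Edge → G => ψ b) (funext fun e' => ?_)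
  simp only [patch_gauge]
  split_ifs <;> ac_rfl

/-- If multiplication by `g` at the edge `e` changes the monodromy around each face `f` by `τ f`,
then it transports magnetic charge by `τ`. -/
lemma plaquetteProj_mul_edgeShift {e : Edge} {g : G} {τ : Vertex → G}
    (hτ : ∀ f (c : Edge → G), monodromy f ((plaquetteEdges f).restrict
      (fun e' => if e' = e then g * c e' else c e')) =
        monodromy f ((plaquetteEdges f).restrict c) * τ f) (f : Vertex) (h : G) :
    plaquetteProj f h * edgeShift e g = edgeShift e g * plaquetteProj f (h * τ f) := by
  refine observable_ext fun ψ c => ?_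
  simp only [plaquetteProj, observable_mul_apply, plaquetteOp_apply, edgeShift_apply, hτ,
    mul_left_inj]

omit [Fintype G] [DecidableEq G] in
lemma monodromy_shift_up (v f : Vertex) (g : G) (c : Edge → G) :
    monodromy f ((plaquetteEdges f).restrict
      (fun e' => if e' = (v + (1, 0), true) then g⁻¹ * c e' else c e')) =
        monodromy f ((plaquetteEdges f).restrict c) *
          (Pi.mulSingle v g * Pi.mulSingle (v + (1, 0)) g⁻¹ : Vertex → G) f := by
  simp only [monodromy_restrict, Prod.mk.injEq, and_true, Bool.false_eq_true, and_false, if_false,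
    add_left_inj, Pi.mul_apply, Pi.mulSingle_apply]
  split_ifs <;> simp [mul_assoc, mul_comm, mul_left_comm]

omit [Fintype G] [DecidableEq G] in
lemma monodromy_shift_right (v f : Vertex) (g : G) (c : Edge → G) :
    monodromy f ((plaquetteEdges f).restrict
      (fun e' => if e' = (v + (0, 1), false) then g * c e' else c e')) =
        monodromy f ((plaquetteEdges f).restrict c) *
          (Pi.mulSingle v g * Pi.mulSingle (v + (0, 1)) g⁻¹ : Vertex → G) f := by
  simp only [monodromy_restrict, Prod.mk.injEq, and_true, Bool.true_eq_false, and_false, if_false,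
    add_left_inj, Pi.mul_apply, Pi.mulSingle_apply]
  split_ifs <;> simp [mul_assoc, mul_comm, mul_left_comm]

lemma eventually_mem_starsIn_box (v : Vertex) : ∀ᶠ L in atTop, v ∈ starsIn (box L) := by
  obtain ⟨R, hR⟩ := exists_box (starEdges v)
  filter_upwards [eventually_ge_atTop R] with L hL
  exact (mem_starsIn _ _).2 (hR.trans (box_mono hL))

lemma eventually_mem_plaquettesIn_box (f : Vertex) : ∀ᶠ L in atTop, f ∈ plaquettesIn (box L) := by
  obtain ⟨R, hR⟩ := exists_box (plaquetteEdges f)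
  filter_upwards [eventually_ge_atTop R] with L hL
  exact (mem_plaquettesIn _ _).2 (hR.trans (box_mono hL))

/-- In a ground state no two stars are charged. -/
lemma map_mul_starProj_mul_starProj {ω : Observable G →ₗ[ℂ] ℂ} (hω : ω ∈ groundStates G)
    {v w : Vertex} (hvw : v ≠ w) {χ ξ : Character G} (hχ : χ ≠ 1) (hξ : ξ ≠ 1)
    (A : Observable G) : ω (A * (starProj v χ * starProj w ξ)) = 0 := by
  let E : Set (Observable G) := Set.range
    fun L => ∑ f ∈ plaquettesIn (box L), (1 - plaquetteProj f (1 : G))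
  have hE : ∀ X ∈ E, ∀ U, (∀ f, Commute (plaquetteProj f (1 : G)) U) → Commute X U := by
    rintro _ ⟨L, rfl⟩ U hU
    exact Commute.sum_left _ _ _ fun f _ => (Commute.one_left U).sub_left (hU f)
  have hT : ∀ (e : Edge) (ξ : Character G),
      Pi.mulSingle (M := fun _ => Character G) (edgeSource e) ξ *
        Pi.mulSingle (edgeTarget e) ξ⁻¹ ∈ transports starProj E := fun e ξ =>
    ⟨edgePhase e ξ, ⟨_, _, rfl⟩, star_edgePhase_mul e ξ,
      fun u χ => starProj_mul_edgePhase u χ e ξ,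
      fun X hX => hE X hX _ fun f => commute_plaquetteProj_edgePhase f 1 e ξ⟩
  exact map_mul_eq_zero_of_transports hω isChargeFamily_starProj isLocal_starProj
    commute_starProj (fun X hX v χ => hE X hX _ fun f =>
      (commute_starProj_plaquetteProj v f χ 1).symm)
    (mulSingle_mul_mulSingle_inv_mem _ (fun v ξ => hT (v, false) ξ) (fun v ξ => hT (v, true) ξ))
    (fun L => starsIn (box L)) eventually_mem_starsIn_box _ (fun L => ⟨L, rfl⟩)
    (fun L => hamiltonian_eq _) hvw hχ hξ A

/-- In a ground state no two plaquettes are charged. -/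
lemma map_mul_plaquetteProj_mul_plaquetteProj {ω : Observable G →ₗ[ℂ] ℂ} (hω : ω ∈ groundStates G)
    {f f' : Vertex} (hff' : f ≠ f') {g h : G} (hg : g ≠ 1) (hh : h ≠ 1)
    (A : Observable G) : ω (A * (plaquetteProj f g * plaquetteProj f' h)) = 0 := by
  let E : Set (Observable G) := Set.range
    fun L => ∑ v ∈ starsIn (box L), (1 - starProj v (1 : Character G))
  have hE : ∀ X ∈ E, ∀ U, (∀ v, Commute (starProj v (1 : Character G)) U) → Commute X U := by
    rintro _ ⟨L, rfl⟩ U hU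
    exact Commute.sum_left _ _ _ fun f _ => (Commute.one_left U).sub_left (hU f)
  have hT : ∀ {e : Edge} {g : G} {τ : Vertex → G}, (∀ f (c : Edge → G),
      monodromy f ((plaquetteEdges f).restrict (fun e' => if e' = e then g * c e' else c e')) =
        monodromy f ((plaquetteEdges f).restrict c) * τ f) → τ ∈ transports plaquetteProj E :=
    fun {e g τ} hτ => ⟨edgeShift e g, ⟨_, _, rfl⟩, star_edgeShift_mul e g,
      plaquetteProj_mul_edgeShift hτ,
      fun X hX => hE X hX _ fun v => commute_starProj_edgeShift v 1 e g⟩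
  exact map_mul_eq_zero_of_transports hω isChargeFamily_plaquetteProj isLocal_plaquetteProj
    commute_plaquetteProj (fun X hX f c => hE X hX _ fun v =>
      commute_starProj_plaquetteProj v f 1 c)
    (mulSingle_mul_mulSingle_inv_mem _ (fun v g => hT fun f c => monodromy_shift_up v f g c)
      (fun v g => hT fun f c => monodromy_shift_right v f g c))
    (fun L => plaquettesIn (box L)) eventually_mem_plaquettesIn_box _ (fun L => ⟨L, rfl⟩)
    (fun L => (hamiltonian_eq _).trans (add_comm _ _)) hff' hg hh A

end Transport

/-! ### The charge of a ground state -/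

section Main

variable {G : Type*} [CommGroup G] [Fintype G] [DecidableEq G]

variable (G) in
/-- The commutative star algebra generated by all local charge projections. -/
noncomputable def chargeAlgebra : StarSubalgebra ℂ (Observable G) :=
  StarAlgebra.adjoin ℂ ({X | ∃ v, ∃ χ : Character G, X = starProj v χ} ∪
    {X | ∃ f, ∃ c : G, X = plaquetteProj f c})

instance isMulCommutative_chargeAlgebra : IsMulCommutative (chargeAlgebra G) := by
  have hstar : ∀ X ∈ ({X | ∃ v, ∃ χ : Character G, X = starProj v χ} ∪
      {X | ∃ f, ∃ c : G, X = plaquetteProj f c} : Set (Observable G)), star X = X := by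
    rintro _ (⟨v, χ, rfl⟩ | ⟨f, c, rfl⟩)
    · exact isChargeFamily_starProj.star_eq v χ
    · exact isChargeFamily_plaquetteProj.star_eq f c
  have hcomm : ∀ X ∈ ({X | ∃ v, ∃ χ : Character G, X = starProj v χ} ∪
      {X | ∃ f, ∃ c : G, X = plaquetteProj f c} : Set (Observable G)),
      ∀ Y ∈ ({X | ∃ v, ∃ χ : Character G, X = starProj v χ} ∪
      {X | ∃ f, ∃ c : G, X = plaquetteProj f c} : Set (Observable G)), X * Y = Y * X := by
    rintro _ (⟨v, χ, rfl⟩ | ⟨f, c, rfl⟩) _ (⟨w, ξ, rfl⟩ | ⟨f', d, rfl⟩)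
    · exact commute_starProj v w χ ξ
    · exact commute_starProj_plaquetteProj v f' χ d
    · exact (commute_starProj_plaquetteProj w f ξ c).symm
    · exact commute_plaquetteProj f f' c d
  exact StarAlgebra.isMulCommutative_adjoin ℂ hcomm fun X hX Y hY => by
    rw [hstar Y hY]; exact hcomm X hX Y hY

open scoped IsMulCommutative in
/-- The local charge projections are the images of two families in a commutative star algebra. -/
lemma exists_commutative_charges.{u} (G : Type u) [CommGroup G] [Fintype G] [DecidableEq G] :
    ∃ (C : Type u) (_ : CommRing C) (_ : StarRing C) (_ : Algebra ℂ C)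
      (j : C →⋆ₐ[ℂ] Observable G) (pE : Vertex → Character G → C) (pM : Vertex → G → C),
      Function.Injective j ∧ (∀ v χ, j (pE v χ) = starProj v χ) ∧
      ∀ f c, j (pM f c) = plaquetteProj f c :=
  ⟨chargeAlgebra G, inferInstance, inferInstance, inferInstance, (chargeAlgebra G).subtype,
    fun v χ => ⟨starProj v χ, StarAlgebra.subset_adjoin ℂ _ (Or.inl ⟨v, χ, rfl⟩)⟩,
    fun f c => ⟨plaquetteProj f c, StarAlgebra.subset_adjoin ℂ _ (Or.inr ⟨f, c, rfl⟩)⟩,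
    Subtype.val_injective, fun _ _ => rfl, fun _ _ => rfl⟩

lemma chargeProj_eq {C : Type*} [CommRing C] [StarRing C] [Algebra ℂ C]
    {j : C →⋆ₐ[ℂ] Observable G} {pE : Vertex → Character G → C} {pM : Vertex → G → C}
    (hE : ∀ v χ, j (pE v χ) = starProj v χ) (hM : ∀ f c, j (pM f c) = plaquetteProj f c)
    (L : ℕ) (χ : Character G) (c : G) :
    chargeProj L χ c = j (totalCharge pE (starsIn (box L)) χ *
      totalCharge pM (plaquettesIn (box L)) c) := by
  rw [map_mul, chargeProj, electricProj, magneticProj,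
    map_totalCharge j hE fun _ _ _ _ _ _ => commute_starProj _ _ _ _,
    map_totalCharge j hM fun _ _ _ _ _ _ => commute_plaquetteProj _ _ _ _]

lemma star_chargeProj_and_mul_self (L : ℕ) (χ : Character G) (c : G) :
    star (chargeProj L χ c) = chargeProj L χ c ∧
      chargeProj L χ c * chargeProj L χ c = chargeProj L χ c := by
  obtain ⟨C, _, _, _, j, pE, pM, hj, hE, hM⟩ := exists_commutative_charges G
  have hcE := isChargeFamily_starProj.of_injective j hj hE
  have hcM := isChargeFamily_plaquetteProj.of_injective j hj hM
  rw [chargeProj_eq hE hM]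
  constructor
  · rw [← map_star, star_mul', hcE.star_totalCharge, hcM.star_totalCharge]
  · rw [← map_mul, mul_mul_mul_comm, hcE.totalCharge_mul_self, hcM.totalCharge_mul_self]

lemma star_chargeProj (L : ℕ) (χ : Character G) (c : G) :
    star (chargeProj L χ c) = chargeProj L χ c :=
  (star_chargeProj_and_mul_self L χ c).1

lemma chargeProj_mul_self (L : ℕ) (χ : Character G) (c : G) :
    chargeProj L χ c * chargeProj L χ c = chargeProj L χ c :=
  (star_chargeProj_and_mul_self L χ c).2

lemma star_one_sub_chargeProj_mul (L : ℕ) (χ : Character G) (c : G) :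
    star (1 - chargeProj L χ c) * (1 - chargeProj L χ c) = 1 - chargeProj L χ c := by
  rw [star_sub, star_one, star_chargeProj, sub_mul, one_mul, mul_sub, mul_one,
    chargeProj_mul_self, sub_self, sub_zero]

lemma map_chargeProj_mem_Icc {ω : Observable G →ₗ[ℂ] ℂ} (hω : ω ∈ states G) (L : ℕ)
    (χ : Character G) (c : G) :
    ω (chargeProj L χ c) = (ω (chargeProj L χ c)).re ∧ (ω (chargeProj L χ c)).re ≤ 1 := by
  have h1 := hω.1 (chargeProj L χ c)
  have h2 := hω.1 (1 - chargeProj L χ c)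
  rw [star_chargeProj, chargeProj_mul_self] at h1
  rw [star_one_sub_chargeProj_mul, map_sub, hω.2] at h2
  have h3 := (Complex.nonneg_iff.1 h2).1
  rw [Complex.sub_re, Complex.one_re] at h3
  exact ⟨Complex.ext rfl (Complex.nonneg_iff.1 h1).2.symm, by linarith⟩

lemma monotone_starsIn_box : Monotone fun L => starsIn (box L) := fun _ _ h v hv =>
  (mem_starsIn _ v).2 (((mem_starsIn _ v).1 hv).trans (box_mono h))

lemma monotone_plaquettesIn_box : Monotone fun L => plaquettesIn (box L) := fun _ _ h v hv =>
  (mem_plaquettesIn _ v).2 (((mem_plaquettesIn _ v).1 hv).trans (box_mono h))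

/-- In a ground state, for `M ≤ L` it is unlikely, uniformly in `L`, that the charge is `(χ, c)` in
the box `L` but not in the box `M`. -/
lemma exists_tendsto_zero_bound_chargeProj {ω : Observable G →ₗ[ℂ] ℂ} (hω : ω ∈ groundStates G)
    (χ : Character G) (c : G) :
    ∃ u : ℕ → ℝ, Tendsto u atTop (𝓝 0) ∧ ∀ M L, M ≤ L →
      (ω (chargeProj L χ c)).re - (ω (chargeProj M χ c * chargeProj L χ c)).re ≤ u M := by
  obtain ⟨C, _, _, _, j, pE, pM, hj, hE, hM⟩ := exists_commutative_charges G
  have hcE := isChargeFamily_starProj.of_injective j hj hE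
  have hcM := isChargeFamily_plaquetteProj.of_injective j hj hM
  let ω' : C →ₗ[ℂ] ℂ := ω ∘ₗ j.toAlgHom.toLinearMap
  have hω'j : ∀ A, ω' A = ω (j A) := fun _ => rfl
  have hω' : ∀ A, 0 ≤ ω' (star A * A) := fun A => by
    rw [hω'j, map_mul, map_star]; exact hω.1.1 _
  obtain ⟨u, hu, hu'⟩ := hcE.exists_tendsto_zero_bound hω'
    (fun v w hvw χ ξ hχ hξ A => by
      rw [hω'j, map_mul j, map_mul j, hE, hE]
      exact map_mul_starProj_mul_starProj hω hvw hχ hξ _) monotone_starsIn_box χ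
  obtain ⟨u', hu0, hu0'⟩ := hcM.exists_tendsto_zero_bound hω'
    (fun v w hvw χ ξ hχ hξ A => by
      rw [hω'j, map_mul j, map_mul j, hM, hM]
      exact map_mul_plaquetteProj_mul_plaquetteProj hω hvw hχ hξ _) monotone_plaquettesIn_box c
  refine ⟨fun M => u M + u' M, by simpa using hu.add hu0, fun M L hML => ?_⟩
  rw [chargeProj_eq hE hM, chargeProj_eq hE hM, ← map_mul, ← hω'j, ← hω'j, ← Complex.sub_re,
    ← map_sub]
  exact (map_mul_sub_le_of_projections hω' (hcE.star_totalCharge _ _)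
    (hcE.totalCharge_mul_self _ _) (hcE.star_totalCharge _ _) (hcE.totalCharge_mul_self _ _)
    (hcM.star_totalCharge _ _) (hcM.totalCharge_mul_self _ _) (hcM.star_totalCharge _ _)
    (hcM.totalCharge_mul_self _ _)).trans (add_le_add (hu' M L hML) (hu0' M L hML))

/-- The states of charge `(χ, c)` are the ground states in which the global charge is almost surely
`(χ, c)`. -/
lemma mem_chargedGroundStates_iff {φ : Observable G →ₗ[ℂ] ℂ} {χ : Character G} {c : G} :
    φ ∈ chargedGroundStates χ c ↔ φ ∈ groundStates G ∧
      Tendsto (fun L => (φ (chargeProj L χ c)).re) atTop (𝓝 1) := by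
  constructor
  · rintro ⟨hφ, ω, hω, ⟨r, hr, hlim⟩, h⟩
    constructor
    · refine mem_groundStates_iff.2 ⟨hφ, fun B k hB hk hδ => ?_⟩
      have h0 := (mem_groundStates_iff.1 hω).2 B k hB hk hδ
      refine tendsto_nhds_unique (h (star B * B)) (tendsto_const_nhds.congr fun L => ?_)
      rw [mul_assoc, map_star_mul_eq_zero_of_null hω.1.1 h0, zero_div]
    · obtain ⟨u, hu, hu'⟩ := exists_tendsto_zero_bound_chargeProj hω χ c
      have hre : Tendsto (fun L => (ω (chargeProj L χ c)).re) atTop (𝓝 r) :=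
        (Complex.continuous_re.tendsto _).comp hlim
      have hbound : ∀ M, 1 - u M / r ≤ (φ (chargeProj M χ c)).re := by
        intro M
        have h1 : Tendsto (fun L : ℕ => (ω (chargeProj M χ c * chargeProj L χ c) /
            ω (chargeProj L χ c)).re) atTop (𝓝 (φ (chargeProj M χ c)).re) :=
          (Complex.continuous_re.tendsto _).comp (h (chargeProj M χ c))
        have h2 : Tendsto (fun L : ℕ => 1 - u M / (ω (chargeProj L χ c)).re) atTop
            (𝓝 (1 - u M / r)) := (tendsto_const_nhds.div hre hr.ne').const_sub 1
        refine le_of_tendsto_of_tendsto h2 h1 ?_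
        filter_upwards [hre.eventually (lt_mem_nhds hr), eventually_ge_atTop M] with L hL hML
        have h3 := hu' M L hML
        rw [(map_chargeProj_mem_Icc hω.1 L χ c).1, Complex.div_ofReal_re, Complex.ofReal_re,
          one_sub_div hL.ne']
        gcongr
        linarith
      refine tendsto_of_tendsto_of_tendsto_of_le_of_le ?_ tendsto_const_nhds hbound
        fun M => (map_chargeProj_mem_Icc hφ M χ c).2
      simpa using (hu.div_const r).const_sub 1
  · rintro ⟨hφ, h⟩
    have hlim : Tendsto (fun L => φ (chargeProj L χ c)) atTop (𝓝 ((1 : ℝ) : ℂ)) :=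
      ((Complex.continuous_ofReal.tendsto 1).comp h).congr fun L =>
        (map_chargeProj_mem_Icc hφ.1 L χ c).1.symm
    refine ⟨hφ.1, φ, hφ, ⟨1, one_pos, hlim⟩, fun A => ?_⟩
    -- By Cauchy–Schwarz `φ (A (1 - D))` is small when `φ (1 - D)` is.
    have h0 : Tendsto (fun L => φ (A * (1 - chargeProj L χ c))) atTop (𝓝 0) := by
      have hle : ∀ L, ‖φ (A * (1 - chargeProj L χ c))‖ ^ 2 ≤
          (φ (A * star A)).re * (1 - (φ (chargeProj L χ c)).re) := fun L => by
        have h1 := norm_map_star_mul_sq_le hφ.1.1 (star A) (1 - chargeProj L χ c)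
        rwa [star_star, star_one_sub_chargeProj_mul, map_sub φ 1, hφ.1.2, Complex.sub_re,
          Complex.one_re] at h1
      have hz : Tendsto (fun L => (φ (A * star A)).re * (1 - (φ (chargeProj L χ c)).re)) atTop
          (𝓝 0) := by
        simpa using (h.const_sub 1).const_mul (φ (A * star A)).re
      have hsq := squeeze_zero (fun L => by positivity) hle hz
      rw [tendsto_zero_iff_norm_tendsto_zero]
      simpa [Real.sqrt_sq] using hsq.sqrt
    have h1 : Tendsto (fun L => φ (A * chargeProj L χ c)) atTop (𝓝 (φ A)) := by
      have := h0.const_sub (φ A)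
      rw [sub_zero] at this
      refine this.congr fun L => ?_
      rw [mul_sub, mul_one, map_sub, sub_sub_cancel]
    have h2 := h1.div hlim (by simp)
    rwa [Complex.ofReal_one, div_one] at h2

lemma convex_states : Convex ℝ (states G) := by
  intro ω₁ h₁ ω₂ h₂ a b ha hb hab
  refine ⟨fun A => ?_, ?_⟩
  · rw [LinearMap.add_apply, LinearMap.smul_apply, LinearMap.smul_apply]
    exact add_nonneg (smul_nonneg ha (h₁.1 A)) (smul_nonneg hb (h₂.1 A))
  · rw [LinearMap.add_apply, LinearMap.smul_apply, LinearMap.smul_apply, h₁.2, h₂.2,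
      ← add_smul, hab, one_smul]

lemma isFace_chargedGroundStates (χ : Character G) (c : G) :
    IsFace (states G) (chargedGroundStates χ c) := by
  refine ⟨?_, ⟨fun φ hφ => hφ.1, ?_⟩⟩
  · intro ω₁ h₁ ω₂ h₂ a b ha hb hab
    rw [mem_chargedGroundStates_iff, mem_groundStates_iff] at *
    refine ⟨⟨convex_states h₁.1.1 h₂.1.1 ha hb hab, fun B k hB hk hδ => ?_⟩, ?_⟩
    · rw [LinearMap.add_apply, LinearMap.smul_apply, LinearMap.smul_apply, h₁.1.2 B k hB hk hδ,
        h₂.1.2 B k hB hk hδ, smul_zero, smul_zero, add_zero]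
    · simpa [hab] using (h₁.2.const_mul a).add (h₂.2.const_mul b)
  · rintro ω₁ h₁ ω₂ h₂ _ hφ ⟨a, b, ha, hb, hab, rfl⟩
    rw [mem_chargedGroundStates_iff, mem_groundStates_iff] at hφ ⊢
    refine ⟨⟨h₁, fun B k hB hk hδ => ?_⟩, ?_⟩
    · have h0 := hφ.1.2 B k hB hk hδ
      rw [LinearMap.add_apply, LinearMap.smul_apply, LinearMap.smul_apply] at h0
      have h3 := (add_eq_zero_iff_of_nonneg (smul_nonneg ha.le (h₁.1 B))
        (smul_nonneg hb.le (h₂.1 B))).1 h0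
      exact (smul_eq_zero.1 h3.1).resolve_left ha.ne'
    · -- `1 ≥ ω₁ D ≥ (φ D - b) / a`, as `ω₂ D ≤ 1`.
      refine tendsto_of_tendsto_of_tendsto_of_le_of_le
        (g := fun L => (((a • ω₁ + b • ω₂) (chargeProj L χ c)).re - b) / a) ?_ tendsto_const_nhds
        (fun L => ?_) fun L => (map_chargeProj_mem_Icc h₁ L χ c).2
      · have := (hφ.2.sub_const b).div_const a
        rwa [← hab, add_sub_cancel_right, div_self ha.ne'] at this
      · have h4 := (map_chargeProj_mem_Icc h₂ L χ c).2
        rw [div_le_iff₀ ha]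
        simp only [LinearMap.add_apply, LinearMap.smul_apply, Complex.add_re, Complex.real_smul,
          Complex.re_ofReal_mul]
        nlinarith

end Main

end QuantumDouble

theorem mainTheorem5 (G : Type*) [CommGroup G] [Fintype G] [DecidableEq G]
    (χ : QuantumDouble.Character G) (c : G) :
    QuantumDouble.IsFace (QuantumDouble.states G) (QuantumDouble.chargedGroundStates χ c) ∧
      ∀ ω ∈ (QuantumDouble.chargedGroundStates χ c).extremePoints ℝ,
        ω ∈ QuantumDouble.pureStates G :=
  ⟨QuantumDouble.isFace_chargedGroundStates χ c,
    (QuantumDouble.isFace_chargedGroundStates χ c).isExtreme.extremePoints_subset_extremePoints⟩
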